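/- **Lemma (density matrices of the non-interacting Gibbs state).** Let $\mathfrak H$ be a separable complex Hilbert space, let $h\ge 0$ be a self-adjoint (possibly unbounded) operator on $\mathfrak H$, and let $1\le p<\infty$ be such that $\operatorname{tr}_{\mathfrak H}(h^{-p})<\infty$ (in particular $h$ has a bounded, everywhere defined inverse $h^{-1}$). Then $\mathfrak H$ has an orthonormal basis $(u_j)$ of eigenvectors of $h$, with eigenvalues $\lambda_j>0$. For any such basis and for $s\in\mathbb R$ let $$\mathfrak H^s=\Big\{(\alpha_j)\subset\mathbb C:\ \|\alpha\|_{\mathfrak H^s}^2=\sum_j\lambda_j^s|\alpha_j|^2<\infty\Big\},$$ so that $\mathfrak H^0\simeq\mathfrak H$ through $x\mapsto(\langle u_j,x\rangle)_j$, the embeddings $\mathfrak H^{p-1}\subset\mathfrak H\subset\mathfrak H^{1-p}$ are continuous, and $\mathfrak H^{1-p}$ is the antidual of $\mathfrak H^{p-1}$ for the pairing $\sum_j\overline{u_j}w_j$. Let $$d\mu_0(u)=\bigotimes_j\Big(\frac{\lambda_j}{\pi}e^{-\lambda_j|\alpha_j|^2}\,d\alpha_j\Big)$$ be the Gaussian measure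 on $\mathfrak H^{1-p}$; it is a Borel probability measure whose projection on any finite set of coordinates is the corresponding finite product. Let $\bigotimes_s^k$ denote the $k$-fold symmetric Hilbert space tensor power, and let $A^{\otimes k}$ be understood as restricted to symmetric tensors. Then, for every integer $k\ge1$: 1. The integral $$\gamma_0^{(k)}=\int_{\mathfrak H^{1-p}}|u^{\otimes k}\rangle\langle u^{\otimes k}|\,d\mu_0(u)$$ converges absolutely (as a Bochner integral) in the space of bounded operators from $\bigotimes_s^k\mathfrak H^{p-1}$ to $\bigotimes_s^k\mathfrak H^{1-p}$. 2. One has $$\gamma_0^{(k)}=k!\,(h^{-1})^{\otimes k},$$ in the sense that $\gamma_0^{(k)}$ is the operator induced by the bounded operator $k!\,(h^{-1})^{\otimes k}$ of $\bigotimes_s^k\mathfrak H$ through the embeddings $\bigotimes_s^k\mathfrak H^{p-1}\to\bigotimes_s^k\mathfrak H\to\bigotimes_s^k\mathfrak H^{1-p}$; and $k!\,(h^{-1})^{\otimes k}$ is the only bounded operator on $\bigotimes_s^k\mathfrak H$ with this property. 3. This extension of $\gamma_0^{(k)}$ to $\bigotimes_s^k\mathfrak H$ is non-negative and compact, and $$\operatorname{tr}_{\bigotimes_s^k\mathfrak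 H}\big(\gamma_0^{(k)}\big)^p\le (k!)^p\big[\operatorname{tr}_{\mathfrak H}(h^{-p})\big]^k<\infty .$$ -/

import Mathlib

open MeasureTheory
open scoped ComplexOrder ENNReal Nat InnerProductSpace

universe u v

noncomputable section

namespace FreeGibbs

/-! ## Traces and powers of non-negative bounded operators, inverses of unbounded operators -/

section Operators

variable {E : Type u} [NormedAddCommGroup E] [InnerProductSpace ℂ E]

theorem parseval_ennreal {ι : Type*} (b : HilbertBasis ι ℂ E) (x : E) :
    ∑' i, ENNReal.ofReal (‖⟪b i, x⟫_ℂ‖ ^ 2) = ENNReal.ofReal (‖x‖ ^ 2) := by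
  have hs : HasSum (fun i => ‖⟪b i, x⟫_ℂ‖ ^ 2) (‖x‖ ^ 2) := by
    have h1 := (b.hasSum_inner_mul_inner x x).mapL RCLike.reCLM
    have h2 : RCLike.reCLM (⟪x, x⟫_ℂ) = ‖x‖ ^ 2 := by
      simpa using inner_self_eq_norm_sq (𝕜 := ℂ) x
    rw [h2] at h1
    refine (congrArg (fun f => HasSum f (‖x‖ ^ 2)) (funext fun i => ?_)).mp h1
    rw [← inner_conj_symm x (b i), RCLike.conj_mul, RCLike.reCLM_apply, ← RCLike.ofReal_pow,
      RCLike.ofReal_re]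
  rw [← ENNReal.ofReal_tsum_of_nonneg (fun i => by positivity) hs.summable, hs.tsum_eq]

variable [CompleteSpace E]

/-- The trace `∑ᵢ ⟨eᵢ, A eᵢ⟩ ∈ [0, ∞]` of a non-negative bounded operator `A`, computed in some
orthonormal basis `(eᵢ)`; by `posTrace_eq_tsum` below the basis does not matter. -/
def posTrace (A : E →L[ℂ] E) : ℝ≥0∞ :=
  ∑' i, ENNReal.ofReal (RCLike.re
    ⟪(exists_hilbertBasis ℂ E).choose_spec.choose i,
      A ((exists_hilbertBasis ℂ E).choose_spec.choose i)⟫_ℂ)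

/-- The power `A ^ p` of a non-negative bounded operator, through the continuous functional
calculus. -/
def opPow (A : E →L[ℂ] E) (p : ℝ) : E →L[ℂ] E :=
  cfc (fun x : ℝ => x ^ p) A

/-- `T` is the inverse, bounded and defined on the whole space, of the (unbounded) operator `h`. -/
def IsBoundedInverse (h : E →ₗ.[ℂ] E) (T : E →L[ℂ] E) : Prop :=
  (∀ y : E, ∃ hy : T y ∈ h.domain, h ⟨T y, hy⟩ = y) ∧ ∀ x : h.domain, T (h x) = x

/-- `(bᵢ)` is an orthonormal basis of eigenvectors of `h`, with positive eigenvalues `(lamᵢ)`. -/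
def IsEigenbasis (h : E →ₗ.[ℂ] E) {ι : Type v} (b : HilbertBasis ι ℂ E)
    (lam : ι → Set.Ioi (0 : ℝ)) : Prop :=
  ∀ i, ∃ hi : b i ∈ h.domain, h ⟨b i, hi⟩ = ((lam i : ℝ) : ℂ) • b i

theorem tsum_inner_eq {ι κ : Type*} (b : HilbertBasis ι ℂ E) (c : HilbertBasis κ ℂ E)
    {A : E →L[ℂ] E} (hA : A.IsPositive) :
    ∑' i, ENNReal.ofReal (RCLike.re ⟪b i, A (b i)⟫_ℂ) =
      ∑' j, ENNReal.ofReal (RCLike.re ⟪c j, A (c j)⟫_ℂ) := by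
  obtain ⟨S, rfl⟩ := CStarAlgebra.nonneg_iff_eq_star_mul_self.mp
    ((ContinuousLinearMap.nonneg_iff_isPositive A).mpr hA)
  have key : ∀ x : E, RCLike.re ⟪x, (star S * S) x⟫_ℂ = ‖S x‖ ^ 2 := by
    intro x
    rw [ContinuousLinearMap.star_eq_adjoint, mul_apply_eq_comp,
      ContinuousLinearMap.adjoint_inner_right]
    exact inner_self_eq_norm_sq (𝕜 := ℂ) (S x)
  have key2 : ∀ x y : E, ‖⟪x, S y⟫_ℂ‖ = ‖⟪y, (star S) x⟫_ℂ‖ := by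
    intro x y
    rw [ContinuousLinearMap.star_eq_adjoint, ContinuousLinearMap.adjoint_inner_right,
      norm_inner_symm]
  have L : ∑' j, ENNReal.ofReal (‖(star S) (c j)‖ ^ 2) =
      ∑' j, ENNReal.ofReal (RCLike.re ⟪c j, (star S * S) (c j)⟫_ℂ) := by
    simp only [key]
    calc ∑' j, ENNReal.ofReal (‖(star S) (c j)‖ ^ 2)
        = ∑' j, ∑' i, ENNReal.ofReal (‖⟪c i, (star S) (c j)⟫_ℂ‖ ^ 2) := by
          simp only [parseval_ennreal]
      _ = ∑' i, ∑' j, ENNReal.ofReal (‖⟪c i, (star S) (c j)⟫_ℂ‖ ^ 2) := ENNReal.tsum_comm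
      _ = ∑' i, ∑' j, ENNReal.ofReal (‖⟪c j, S (c i)⟫_ℂ‖ ^ 2) := by simp only [key2]
      _ = ∑' i, ENNReal.ofReal (‖S (c i)‖ ^ 2) := by simp only [parseval_ennreal]
  rw [← L]
  simp only [key]
  calc ∑' i, ENNReal.ofReal (‖S (b i)‖ ^ 2)
      = ∑' i, ∑' j, ENNReal.ofReal (‖⟪c j, S (b i)⟫_ℂ‖ ^ 2) := by
        simp only [parseval_ennreal]
    _ = ∑' j, ∑' i, ENNReal.ofReal (‖⟪c j, S (b i)⟫_ℂ‖ ^ 2) := ENNReal.tsum_comm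
    _ = ∑' j, ∑' i, ENNReal.ofReal (‖⟪b i, (star S) (c j)⟫_ℂ‖ ^ 2) := by simp only [key2]
    _ = ∑' j, ENNReal.ofReal (‖(star S) (c j)‖ ^ 2) := by simp only [parseval_ennreal]

/-- The trace of a non-negative operator can be computed in any orthonormal basis. -/
theorem posTrace_eq_tsum {ι : Type v} (b : HilbertBasis ι ℂ E)
    {A : E →L[ℂ] E} (hA : A.IsPositive) :
    posTrace A = ∑' i, ENNReal.ofReal (RCLike.re ⟪b i, A (b i)⟫_ℂ) :=
  tsum_inner_eq _ b hA

end Operators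

/-! ## The Hilbert space tensor power -/

section KernelPositivity

variable {X : Type*}

theorem posSemidef_gram_of_family {E : Type u} [NormedAddCommGroup E] [InnerProductSpace ℂ E]
    (v : X → E) : (Matrix.gram ℂ v).PosSemidef := by
  refine ⟨Matrix.isHermitian_gram ℂ v, fun c => ?_⟩
  have h : (c.sum fun i xi => c.sum fun j xj => star xi * Matrix.gram ℂ v i j * xj) =
      ⟪c.sum fun i xi => xi • v i, c.sum fun i xi => xi • v i⟫_ℂ := by
    simp only [Finsupp.sum, sum_inner, inner_smul_left, Finset.mul_sum, inner_sum,
      inner_smul_right, Matrix.gram_apply]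
    rw [Finset.sum_comm]
    refine Finset.sum_congr rfl fun i _ => Finset.sum_congr rfl fun j _ => ?_
    rw [RCLike.star_def]
    ring
  rw [h, inner_self_eq_norm_sq_to_K]
  norm_cast
  positivity

theorem posSemidef_prod {κ : Type*} (s : Finset κ) (M N : κ → Matrix X X ℂ)
    (hM : ∀ i, (M i).PosSemidef) (hNM : ∀ i, (N i - M i).PosSemidef) :
    (Matrix.of fun x y => ∏ i ∈ s, M i x y).PosSemidef ∧
      ((Matrix.of fun x y => ∏ i ∈ s, N i x y) -
        Matrix.of fun x y => ∏ i ∈ s, M i x y).PosSemidef := by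
  classical
  induction s using Finset.induction_on with
  | empty =>
    refine ⟨?_, ?_⟩
    · have h := posSemidef_gram_of_family (fun _ : X => (1 : ℂ))
      convert h using 1
      ext x y
      simp [Matrix.gram_apply]
    · simpa using (Matrix.PosSemidef.zero : (0 : Matrix X X ℂ).PosSemidef)
  | insert a s ha ih =>
    obtain ⟨h1, h2⟩ := ih
    refine ⟨?_, ?_⟩
    · have e : (Matrix.of fun x y => ∏ i ∈ insert a s, M i x y) =
          (M a).hadamard (Matrix.of fun x y => ∏ i ∈ s, M i x y) := by
        ext x y
        simp [Finset.prod_insert ha, Matrix.hadamard_apply]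
      rw [e]
      exact (hM a).hadamard h1
    · have hN : (N a).PosSemidef := by simpa using (hNM a).add (hM a)
      have e : ((Matrix.of fun x y => ∏ i ∈ insert a s, N i x y) -
          Matrix.of fun x y => ∏ i ∈ insert a s, M i x y) =
          (N a).hadamard ((Matrix.of fun x y => ∏ i ∈ s, N i x y) -
            Matrix.of fun x y => ∏ i ∈ s, M i x y) +
          (N a - M a).hadamard (Matrix.of fun x y => ∏ i ∈ s, M i x y) := by
        ext x y
        simp only [Matrix.sub_apply, Matrix.add_apply, Matrix.hadamard_apply, Matrix.of_apply,
          Finset.prod_insert ha]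
        ring
      rw [e]
      exact (hN.hadamard h2).add ((hNM a).hadamard h1)

end KernelPositivity

section TensorPower

variable {E : Type u} [NormedAddCommGroup E] [InnerProductSpace ℂ E]
variable {F : Type v} [NormedAddCommGroup F] [InnerProductSpace ℂ F]

/-- The matrix of the inner products `∏ₗ ⟨xₗ, yₗ⟩` of the elementary tensors
`x₁ ⊗ ⋯ ⊗ xₖ` and `y₁ ⊗ ⋯ ⊗ yₖ`. -/
def tensorKernel (E : Type u) [NormedAddCommGroup E] [InnerProductSpace ℂ E] (k : ℕ) :
    Matrix (Fin k → E) (Fin k → E) ℂ :=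
  Matrix.of fun x y => ∏ l, ⟪x l, y l⟫_ℂ

theorem posSemidef_tensorKernel (k : ℕ) : (tensorKernel E k).PosSemidef := by
  have h := (posSemidef_prod (Finset.univ : Finset (Fin k))
    (fun l => Matrix.gram ℂ fun x : Fin k → E => x l)
    (fun l => Matrix.gram ℂ fun x : Fin k → E => x l)
    (fun l => posSemidef_gram_of_family _)
    (fun l => by simpa using Matrix.PosSemidef.zero)).1
  exact h

theorem posSemidef_tensorKernel_map (k : ℕ) (A : E →L[ℂ] F) :
    (((‖A‖ : ℂ) ^ (2 * k)) • tensorKernel E k -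
      (tensorKernel F k).submatrix (A ∘ ·) (A ∘ ·)).PosSemidef := by
  have h := (posSemidef_prod (Finset.univ : Finset (Fin k))
    (fun l => Matrix.gram ℂ (A ∘ fun x : Fin k → E => x l))
    (fun l => ‖A‖ ^ 2 • Matrix.gram ℂ fun x : Fin k → E => x l)
    (fun l => posSemidef_gram_of_family _)
    (fun l => Matrix.posSemidef_opNorm_smul_gram_sub_gram _ A)).2
  have e : ((‖A‖ : ℂ) ^ (2 * k)) • tensorKernel E k -
      (tensorKernel F k).submatrix (A ∘ ·) (A ∘ ·) =
      (Matrix.of fun x y => ∏ l, (‖A‖ ^ 2 • Matrix.gram ℂ fun x : Fin k → E => x l) x y) -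
        Matrix.of fun x y => ∏ l, Matrix.gram ℂ (A ∘ fun x : Fin k → E => x l) x y := by
    ext x y
    simp [tensorKernel, Matrix.gram_apply, Finset.prod_mul_distrib, pow_mul]
  rw [e]
  exact h

/-- The positive semi-definite inner product on formal finite linear combinations of elementary
tensors that is determined by `⟨x₁ ⊗ ⋯ ⊗ xₖ, y₁ ⊗ ⋯ ⊗ yₖ⟩ = ∏ₗ ⟨xₗ, yₗ⟩`. -/
@[reducible] def tensorCore (E : Type u) [NormedAddCommGroup E] [InnerProductSpace ℂ E] (k : ℕ) :
    PreInnerProductSpace.Core ℂ ((Fin k → E) →₀ ℂ) where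
  inner f g := f.sum fun x a => g.sum fun y c => star a * tensorKernel E k x y * c
  conj_inner_symm f g := by
    rw [Finsupp.sum_comm]
    simp only [map_finsuppSum]
    refine Finsupp.sum_congr fun x _ => Finsupp.sum_congr fun y _ => ?_
    rw [← (posSemidef_tensorKernel (E := E) k).1.apply x y]
    simp only [map_mul, RCLike.star_def, RCLike.conj_conj]
    ring
  re_inner_nonneg f := (RCLike.le_iff_re_im.mp ((posSemidef_tensorKernel (E := E) k).2 f)).1
  add_left f g e := by
    classical
    refine Finsupp.sum_add_index' (fun x => ?_) (fun x a a' => ?_)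
    · simp
    · simp only [star_add, add_mul]
      exact Finsupp.sum_add
  smul_left f g r := by
    refine (Finsupp.sum_smul_index' fun x => ?_).trans ?_
    · simp
    · simp only [Finsupp.mul_sum, smul_eq_mul, star_mul', RCLike.star_def, mul_assoc]

/-- Formal finite linear combinations of elementary tensors `x₁ ⊗ ⋯ ⊗ xₖ` of vectors of `E`. -/
def PreTensor (E : Type u) (k : ℕ) : Type u := (Fin k → E) →₀ ℂ

instance (k : ℕ) : AddCommGroup (PreTensor E k) :=
  inferInstanceAs (AddCommGroup ((Fin k → E) →₀ ℂ))

instance (k : ℕ) : Module ℂ (PreTensor E k) :=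
  inferInstanceAs (Module ℂ ((Fin k → E) →₀ ℂ))

instance preTensorCore (k : ℕ) : PreInnerProductSpace.Core ℂ (PreTensor E k) := tensorCore E k

instance (k : ℕ) : SeminormedAddCommGroup (PreTensor E k) :=
  InnerProductSpace.Core.toSeminormedAddCommGroup (𝕜 := ℂ)

instance (k : ℕ) : InnerProductSpace ℂ (PreTensor E k) := InnerProductSpace.ofCore _

/-- The Hilbert space `⨂ᵏ E`: the (separated) completion of the span of the elementary tensors. -/
def TensorPower (E : Type u) [NormedAddCommGroup E] [InnerProductSpace ℂ E] (k : ℕ) : Type u :=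
  UniformSpace.Completion (PreTensor E k)

instance (k : ℕ) : NormedAddCommGroup (TensorPower E k) :=
  inferInstanceAs (NormedAddCommGroup (UniformSpace.Completion (PreTensor E k)))

instance (k : ℕ) : InnerProductSpace ℂ (TensorPower E k) :=
  inferInstanceAs (InnerProductSpace ℂ (UniformSpace.Completion (PreTensor E k)))

instance (k : ℕ) : CompleteSpace (TensorPower E k) :=
  inferInstanceAs (CompleteSpace (UniformSpace.Completion (PreTensor E k)))

/-- The canonical map from formal linear combinations to `⨂ᵏ E`. -/
def toTensorPower (E : Type u) [NormedAddCommGroup E] [InnerProductSpace ℂ E] (k : ℕ) :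
    PreTensor E k →L[ℂ] TensorPower E k :=
  UniformSpace.Completion.toComplL (𝕜 := ℂ) (E := PreTensor E k)

theorem denseRange_toTensorPower (k : ℕ) : DenseRange (toTensorPower E k) :=
  UniformSpace.Completion.denseRange_coe

theorem isUniformInducing_toTensorPower (k : ℕ) : IsUniformInducing (toTensorPower E k) :=
  UniformSpace.Completion.isUniformInducing_coe _

theorem inner_toTensorPower {k : ℕ} (f g : PreTensor E k) :
    ⟪toTensorPower E k f, toTensorPower E k g⟫_ℂ = ⟪f, g⟫_ℂ :=
  UniformSpace.Completion.inner_coe f g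

/-- The formal elementary tensor. -/
def preTensor {k : ℕ} (x : Fin k → E) : PreTensor E k := Finsupp.single x (1 : ℂ)

/-- The elementary tensor `x₁ ⊗ ⋯ ⊗ xₖ`. -/
def tensor {k : ℕ} (x : Fin k → E) : TensorPower E k := toTensorPower E k (preTensor x)

theorem inner_preTensor_def {k : ℕ} (f g : PreTensor E k) :
    ⟪f, g⟫_ℂ = Finsupp.sum f fun x a =>
      Finsupp.sum g fun y c => star a * tensorKernel E k x y * c := rfl

theorem inner_tensor {k : ℕ} (x y : Fin k → E) :
    ⟪tensor x, tensor y⟫_ℂ = ∏ l, ⟪x l, y l⟫_ℂ := by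
  rw [tensor, tensor, inner_toTensorPower, inner_preTensor_def]
  simp [preTensor, tensorKernel]

theorem span_preTensor (k : ℕ) :
    Submodule.span ℂ (Set.range (preTensor : (Fin k → E) → PreTensor E k)) = ⊤ := by
  rw [eq_top_iff]
  intro f _
  have h : f ∈ Submodule.span ℂ
      (Set.range fun x : Fin k → E => (Finsupp.single x (1 : ℂ) : (Fin k → E) →₀ ℂ)) := by
    have h' := Submodule.sum_mem (Submodule.span ℂ
      (Set.range fun x : Fin k → E => (Finsupp.single x (1 : ℂ) : (Fin k → E) →₀ ℂ)))
      (t := Finsupp.support (show (Fin k → E) →₀ ℂ from f))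
      (f := fun x => (show (Fin k → E) →₀ ℂ from f) x • Finsupp.single x (1 : ℂ))
      (fun x _ => Submodule.smul_mem _ _ (Submodule.subset_span ⟨x, rfl⟩))
    have e : f = ∑ x ∈ Finsupp.support (show (Fin k → E) →₀ ℂ from f),
        (show (Fin k → E) →₀ ℂ from f) x • (Finsupp.single x (1 : ℂ) : (Fin k → E) →₀ ℂ) := by
      refine (Finsupp.sum_single (show (Fin k → E) →₀ ℂ from f)).symm.trans ?_
      simp [Finsupp.sum]
    rw [e]
    exact h'
  exact h

theorem dense_span_tensor (k : ℕ) :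
    (Submodule.span ℂ (Set.range (tensor : (Fin k → E) → TensorPower E k))).topologicalClosure
      = ⊤ := by
  rw [← Submodule.dense_iff_topologicalClosure_eq_top]
  refine (denseRange_toTensorPower k).mono ?_
  rintro _ ⟨f, rfl⟩
  have hf : f ∈ Submodule.span ℂ (Set.range (preTensor : (Fin k → E) → PreTensor E k)) := by
    rw [span_preTensor]; trivial
  have := Submodule.mem_map_of_mem
    (f := (toTensorPower E k).toLinearMap) hf
  rw [Submodule.map_span, ← Set.range_comp] at this
  exact this

/-- The action of `A ⊗ ⋯ ⊗ A` on formal linear combinations of elementary tensors. -/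
def preMap (k : ℕ) (A : E →L[ℂ] F) : PreTensor E k →ₗ[ℂ] PreTensor F k :=
  Finsupp.lmapDomain ℂ ℂ fun x : Fin k → E => A ∘ x

theorem inner_map_map (k : ℕ) (A : E →L[ℂ] F) (f : (Fin k → E) →₀ ℂ) :
    (tensorCore F k).inner (f.mapDomain (A ∘ ·)) (f.mapDomain (A ∘ ·)) =
      f.sum fun x a => f.sum fun y c => star a * tensorKernel F k (A ∘ x) (A ∘ y) * c := by
  refine (Finsupp.sum_mapDomain_index (fun x => ?_) (fun x a a' => ?_)).trans ?_
  · simp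
  · simp only [star_add, add_mul]
    exact Finsupp.sum_add
  · refine Finsupp.sum_congr fun x _ => ?_
    refine Finsupp.sum_mapDomain_index (fun y => ?_) (fun y c c' => ?_)
    · simp
    · ring

theorem kernel_sub (k : ℕ) (A : E →L[ℂ] F) (f : (Fin k → E) →₀ ℂ) :
    (f.sum fun x a => f.sum fun y c =>
        star a * (((‖A‖ : ℂ) ^ (2 * k)) • tensorKernel E k -
          (tensorKernel F k).submatrix (A ∘ ·) (A ∘ ·)) x y * c) =
      ((‖A‖ : ℂ) ^ (2 * k)) * (tensorCore E k).inner f f -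
        (tensorCore F k).inner (f.mapDomain (A ∘ ·)) (f.mapDomain (A ∘ ·)) := by
  rw [inner_map_map]
  change _ = _ * (f.sum fun x a => f.sum fun y c => star a * tensorKernel E k x y * c) - _
  simp only [Finsupp.sum, Finset.mul_sum, ← Finset.sum_sub_distrib, Matrix.sub_apply,
    Matrix.smul_apply, Matrix.submatrix_apply, smul_eq_mul]
  refine Finset.sum_congr rfl fun x _ => Finset.sum_congr rfl fun y _ => ?_
  ring

theorem norm_preMap_le (k : ℕ) (A : E →L[ℂ] F) (f : PreTensor E k) :
    ‖preMap k A f‖ ≤ ‖A‖ ^ k * ‖f‖ := by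
  have h := (RCLike.le_iff_re_im.mp ((posSemidef_tensorKernel_map k A).2 f)).1
  have h2 := kernel_sub k A f
  change _ = ((‖A‖ : ℂ) ^ (2 * k)) * ⟪f, f⟫_ℂ - ⟪preMap k A f, preMap k A f⟫_ℂ at h2
  rw [h2, inner_self_eq_norm_sq_to_K, inner_self_eq_norm_sq_to_K] at h
  have h3 : 0 ≤ ‖A‖ ^ (2 * k) * ‖f‖ ^ 2 - ‖preMap k A f‖ ^ 2 := by
    have e : ((‖A‖ : ℂ) ^ (2 * k)) * ((‖f‖ : ℝ) : ℂ) ^ 2 - ((‖preMap k A f‖ : ℝ) : ℂ) ^ 2 =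
      ((‖A‖ ^ (2 * k) * ‖f‖ ^ 2 - ‖preMap k A f‖ ^ 2 : ℝ) : ℂ) := by push_cast; ring
    have h' := h
    change RCLike.re (0 : ℂ) ≤ RCLike.re
      (((‖A‖ : ℂ) ^ (2 * k)) * ((‖f‖ : ℝ) : ℂ) ^ 2 - ((‖preMap k A f‖ : ℝ) : ℂ) ^ 2) at h'
    rw [e] at h'
    have h'' : (0 : ℝ) ≤ RCLike.re
      ((‖A‖ ^ (2 * k) * ‖f‖ ^ 2 - ‖preMap k A f‖ ^ 2 : ℝ) : ℂ) := by simpa only [map_zero] using h'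
    exact h''.trans_eq (Complex.ofReal_re _)
  refine abs_le_of_sq_le_sq' ?_ (by positivity) |>.2
  calc ‖preMap k A f‖ ^ 2 ≤ ‖A‖ ^ (2 * k) * ‖f‖ ^ 2 := by linarith
    _ = (‖A‖ ^ k * ‖f‖) ^ 2 := by ring

/-- The bounded operator `A^{⊗k} : ⨂ᵏ E → ⨂ᵏ F`. -/
def tensorMap (k : ℕ) (A : E →L[ℂ] F) : TensorPower E k →L[ℂ] TensorPower F k :=
  ((toTensorPower F k).comp
    ((preMap k A).mkContinuous (‖A‖ ^ k) (norm_preMap_le k A))).extend (toTensorPower E k)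

theorem tensorMap_tensor {k : ℕ} (A : E →L[ℂ] F) (x : Fin k → E) :
    tensorMap k A (tensor x) = tensor fun l => A (x l) := by
  have h := ContinuousLinearMap.extend_eq
    ((toTensorPower F k).comp
      ((preMap k A).mkContinuous (‖A‖ ^ k) (norm_preMap_le k A)))
    (denseRange_toTensorPower k) (isUniformInducing_toTensorPower k) (preTensor x)
  refine h.trans ?_
  have h2 : preMap k A (preTensor x) = preTensor fun l => A (x l) :=
    Finsupp.mapDomain_single
  change toTensorPower F k (preMap k A (preTensor x)) = _
  rw [h2]
  rfl

/-- The symmetric tensor product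
`x₁ ⊗ₛ ⋯ ⊗ₛ xₖ = (k!)^{-1/2} ∑_σ x_{σ(1)} ⊗ ⋯ ⊗ x_{σ(k)}`. -/
def symProd {k : ℕ} (x : Fin k → E) : TensorPower E k :=
  (((Real.sqrt (k ! : ℝ))⁻¹ : ℝ) : ℂ) • ∑ σ : Equiv.Perm (Fin k), tensor fun l => x (σ l)

/-- The symmetric tensor power `⨂ₛᵏ E`, the closed subspace of `⨂ᵏ E` spanned by the symmetric
tensor products. -/
def symSubspace (E : Type u) [NormedAddCommGroup E] [InnerProductSpace ℂ E] (k : ℕ) :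
    Submodule ℂ (TensorPower E k) :=
  (Submodule.span ℂ (Set.range (symProd : (Fin k → E) → TensorPower E k))).topologicalClosure

/-- The Hilbert space `⨂ₛᵏ E`. -/
def SymPower (E : Type u) [NormedAddCommGroup E] [InnerProductSpace ℂ E] (k : ℕ) : Type u :=
  symSubspace E k

instance (k : ℕ) : NormedAddCommGroup (SymPower E k) :=
  inferInstanceAs (NormedAddCommGroup (symSubspace E k))

instance (k : ℕ) : InnerProductSpace ℂ (SymPower E k) :=
  inferInstanceAs (InnerProductSpace ℂ (symSubspace E k))

instance (k : ℕ) : CompleteSpace (SymPower E k) :=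
  inferInstanceAs (CompleteSpace (Submodule.topologicalClosure
    (Submodule.span ℂ (Set.range (symProd : (Fin k → E) → TensorPower E k)))))

/-- The inclusion of `⨂ₛᵏ E` in `⨂ᵏ E`. -/
def symIncl (E : Type u) [NormedAddCommGroup E] [InnerProductSpace ℂ E] (k : ℕ) :
    SymPower E k →L[ℂ] TensorPower E k :=
  (symSubspace E k).subtypeL

theorem tensorMap_symProd {k : ℕ} (A : E →L[ℂ] F) (x : Fin k → E) :
    tensorMap k A (symProd x) = symProd fun l => A (x l) := by
  simp [symProd, tensorMap_tensor]

theorem tensorMap_mem {k : ℕ} (A : E →L[ℂ] F) (t : TensorPower E k) (ht : t ∈ symSubspace E k) :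
    tensorMap k A t ∈ symSubspace F k := by
  have hle : Submodule.span ℂ (Set.range (symProd : (Fin k → E) → TensorPower E k)) ≤
      (symSubspace F k).comap (tensorMap k A).toLinearMap := by
    rw [Submodule.span_le]
    rintro _ ⟨x, rfl⟩
    change tensorMap k A (symProd x) ∈ symSubspace F k
    rw [tensorMap_symProd]
    exact Submodule.le_topologicalClosure _ (Submodule.subset_span ⟨_, rfl⟩)
  have hcl : IsClosed (((symSubspace F k).comap (tensorMap k A).toLinearMap :
      Submodule ℂ (TensorPower E k)) : Set (TensorPower E k)) :=
    (Submodule.isClosed_topologicalClosure _).preimage (tensorMap k A).continuous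
  exact Submodule.topologicalClosure_minimal _ hle hcl ht

/-- The operator `A^{⊗k}` between the symmetric tensor powers, the restriction of `tensorMap`. -/
def symMap (k : ℕ) (A : E →L[ℂ] F) : SymPower E k →L[ℂ] SymPower F k :=
  ((tensorMap k A).comp (symIncl E k)).codRestrict (symSubspace F k)
    fun t => tensorMap_mem A (symIncl E k t) (Subtype.property (p := (· ∈ symSubspace E k)) t)

theorem symIncl_symMap {k : ℕ} (A : E →L[ℂ] F) (t : SymPower E k) :
    symIncl F k (symMap k A t) = tensorMap k A (symIncl E k t) := rfl

theorem tensor_const_mem (k : ℕ) (x : E) : tensor (fun _ : Fin k => x) ∈ symSubspace E k := by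
  have h : tensor (fun _ : Fin k => x) =
      ((Real.sqrt (k ! : ℝ) / (k ! : ℝ) : ℝ) : ℂ) • symProd (fun _ : Fin k => x) := by
    have hk : (k ! : ℝ) ≠ 0 := by positivity
    have hs : Real.sqrt (k ! : ℝ) ≠ 0 := by positivity
    have e : (((Real.sqrt (k ! : ℝ) / (k ! : ℝ) : ℝ) : ℂ) *
        ((((Real.sqrt (k ! : ℝ))⁻¹ : ℝ) : ℂ) * (k ! : ℂ))) = 1 := by
      have : Real.sqrt (k ! : ℝ) / (k ! : ℝ) * ((Real.sqrt (k ! : ℝ))⁻¹ * (k ! : ℝ)) = 1 := by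
        field_simp
      exact_mod_cast congrArg (fun r : ℝ => (r : ℂ)) this
    rw [symProd, Finset.sum_const, Finset.card_univ, Fintype.card_perm, Fintype.card_fin,
      ← Nat.cast_smul_eq_nsmul ℂ, smul_smul, smul_smul, mul_assoc, e, one_smul]
  rw [h]
  exact Submodule.smul_mem _ _
    (Submodule.le_topologicalClosure _ (Submodule.subset_span ⟨_, rfl⟩))

/-- The vector `x^{⊗k}` of `⨂ₛᵏ E`. -/
def symPow (k : ℕ) (x : E) : SymPower E k := ⟨tensor fun _ => x, tensor_const_mem k x⟩

end TensorPower

/-! ## The Sobolev-type scale -/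

section SobolevSpace

variable {ι : Type v}

/-- The families `α` with `∑ⱼ lamⱼ ^ s |αⱼ|² < ∞`. -/
def sobolevSubmodule (lam : ι → Set.Ioi (0 : ℝ)) (s : ℝ) : Submodule ℂ (ι → ℂ) where
  carrier := {α | Summable fun j => (lam j : ℝ) ^ s * ‖α j‖ ^ 2}
  zero_mem' := by simp
  add_mem' {α β} hα hβ := by
    have hw : ∀ j, 0 ≤ (lam j : ℝ) ^ s := fun j => Real.rpow_nonneg (le_of_lt (lam j).2) s
    refine Summable.of_nonneg_of_le (fun j => mul_nonneg (hw j) (by positivity)) (fun j => ?_)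
      ((Summable.mul_left 2 hα).add (Summable.mul_left 2 hβ))
    have h1 : ‖(α + β) j‖ ^ 2 ≤ 2 * ‖α j‖ ^ 2 + 2 * ‖β j‖ ^ 2 := by
      have h0 : ‖(α + β) j‖ ≤ ‖α j‖ + ‖β j‖ := norm_add_le _ _
      nlinarith [sq_nonneg (‖α j‖ - ‖β j‖), norm_nonneg ((α + β) j), norm_nonneg (α j),
        norm_nonneg (β j)]
    calc (lam j : ℝ) ^ s * ‖(α + β) j‖ ^ 2
        ≤ (lam j : ℝ) ^ s * (2 * ‖α j‖ ^ 2 + 2 * ‖β j‖ ^ 2) :=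
          mul_le_mul_of_nonneg_left h1 (hw j)
      _ = _ := by ring
  smul_mem' c α hα := by
    refine (Summable.mul_left (‖c‖ ^ 2) hα).congr fun j => ?_
    simp only [Pi.smul_apply, smul_eq_mul, norm_mul]
    ring

/-- The space `𝓗ˢ`, `s ∈ ℝ`, identified with a weighted `ℓ²` space through the coordinates in an
eigenbasis of `h` with eigenvalues `lam`. -/
def Sobolev (lam : ι → Set.Ioi (0 : ℝ)) (s : ℝ) : Type v := sobolevSubmodule lam s

variable {lam : ι → Set.Ioi (0 : ℝ)} {s : ℝ}

/-- The vector space structure of `𝓗ˢ`. -/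
@[reducible] def sobolevAddCommGroup (lam : ι → Set.Ioi (0 : ℝ)) (s : ℝ) :
    AddCommGroup (Sobolev lam s) :=
  inferInstanceAs (AddCommGroup (sobolevSubmodule lam s))

attribute [local instance] sobolevAddCommGroup

/-- The vector space structure of `𝓗ˢ`. -/
@[reducible] def sobolevModule (lam : ι → Set.Ioi (0 : ℝ)) (s : ℝ) : Module ℂ (Sobolev lam s) :=
  inferInstanceAs (Module ℂ (sobolevSubmodule lam s))

attribute [local instance] sobolevModule

/-- The family of coordinates of an element of `𝓗ˢ`. -/
def coord (x : Sobolev lam s) : ι → ℂ := (show sobolevSubmodule lam s from x).1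

theorem coord_injective : Function.Injective (coord : Sobolev lam s → ι → ℂ) :=
  Subtype.val_injective

theorem summable_coord (x : Sobolev lam s) :
    Summable fun j => (lam j : ℝ) ^ s * ‖coord x j‖ ^ 2 :=
  (show sobolevSubmodule lam s from x).2

theorem norm_weight_mul (j : ι) (z : ℂ) :
    ‖(((lam j : ℝ) ^ (s / 2) : ℝ) : ℂ) * z‖ ^ 2 = (lam j : ℝ) ^ s * ‖z‖ ^ 2 := by
  have h0 : 0 < (lam j : ℝ) := (lam j).2
  rw [norm_mul, mul_pow, Complex.norm_real, Real.norm_of_nonneg (Real.rpow_nonneg h0.le _),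
    ← Real.rpow_natCast, ← Real.rpow_mul h0.le]
  norm_num

/-- The linear bijection `α ↦ (lamⱼ ^ (s/2) αⱼ)ⱼ` of `𝓗ˢ` with the unweighted `ℓ²`. -/
def toL2 (lam : ι → Set.Ioi (0 : ℝ)) (s : ℝ) :
    Sobolev lam s ≃ₗ[ℂ] lp (fun _ : ι => ℂ) 2 where
  toFun x := ⟨fun j => (((lam j : ℝ) ^ (s / 2) : ℝ) : ℂ) * coord x j, by
    refine memℓp_gen ?_
    refine (summable_coord x).congr fun j => ?_
    simpa using (norm_weight_mul (s := s) j (coord x j)).symm⟩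
  map_add' x y := by
    ext j
    exact mul_add _ _ _
  map_smul' c x := by
    ext j
    exact mul_left_comm _ _ _
  invFun f := ⟨fun j => ((((lam j : ℝ) ^ (s / 2))⁻¹ : ℝ) : ℂ) * f j, by
    have hf := (lp.memℓp f).summable (by norm_num)
    refine hf.congr fun j => ?_
    have h0 : 0 < (lam j : ℝ) ^ (s / 2) := Real.rpow_pos_of_pos (lam j).2 _
    rw [← norm_weight_mul, ← mul_assoc, ← Complex.ofReal_mul, mul_inv_cancel₀ h0.ne']
    simp⟩
  left_inv x := by
    refine coord_injective (funext fun j => ?_)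
    have h0 : 0 < (lam j : ℝ) ^ (s / 2) := Real.rpow_pos_of_pos (lam j).2 _
    change ((((lam j : ℝ) ^ (s / 2))⁻¹ : ℝ) : ℂ) * ((((lam j : ℝ) ^ (s / 2) : ℝ) : ℂ) * coord x j)
      = coord x j
    rw [← mul_assoc, ← Complex.ofReal_mul, inv_mul_cancel₀ h0.ne']
    simp
  right_inv f := by
    ext j
    have h0 : 0 < (lam j : ℝ) ^ (s / 2) := Real.rpow_pos_of_pos (lam j).2 _
    change (((lam j : ℝ) ^ (s / 2) : ℝ) : ℂ) * (((((lam j : ℝ) ^ (s / 2))⁻¹ : ℝ) : ℂ) * f j) = f j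
    rw [← mul_assoc, ← Complex.ofReal_mul, mul_inv_cancel₀ h0.ne']
    simp

/-- The norm of `𝓗ˢ`; see `norm_sq_eq` below for the formula. -/
instance : NormedAddCommGroup (Sobolev lam s) :=
  NormedAddCommGroup.induced _ _ (toL2 lam s) (toL2 lam s).injective

instance : InnerProductSpace ℂ (Sobolev lam s) where
  inner x y := ⟪toL2 lam s x, toL2 lam s y⟫_ℂ
  norm_smul_le c x := by
    change ‖toL2 lam s (c • x)‖ ≤ ‖c‖ * ‖toL2 lam s x‖
    rw [map_smul]
    exact norm_smul_le _ _
  norm_sq_eq_re_inner x := norm_sq_eq_re_inner (𝕜 := ℂ) (toL2 lam s x)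
  conj_inner_symm x y := inner_conj_symm _ _
  add_left x y z := by
    rw [map_add]
    exact inner_add_left _ _ _
  smul_left x y c := by
    rw [map_smul]
    exact inner_smul_left _ _ _

end SobolevSpace

section Sobolev

variable {ι : Type v} {lam : ι → Set.Ioi (0 : ℝ)} {s : ℝ}

theorem norm_sq_eq (x : Sobolev lam s) :
    ‖x‖ ^ 2 = ∑' j, (lam j : ℝ) ^ s * ‖coord x j‖ ^ 2 := by
  have h : ‖x‖ ^ (2 : ℝ≥0∞).toReal = _ :=
    lp.norm_rpow_eq_tsum (p := 2) (by norm_num) (toL2 lam s x)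
  simp only [ENNReal.toReal_ofNat, Real.rpow_ofNat] at h
  rw [h]
  exact tsum_congr fun j => norm_weight_mul j (coord x j)

instance : CompleteSpace (Sobolev lam s) := by
  have hi : Isometry (toL2 lam s) := AddMonoidHomClass.isometry_of_norm _ fun _ => rfl
  exact (IsometryEquiv.mk (toL2 lam s).toEquiv hi).completeSpace

instance : MeasurableSpace (Sobolev lam s) := borel _

instance : BorelSpace (Sobolev lam s) := ⟨rfl⟩

/-- The identification of `𝓗^{1-p}` with the (anti)dual of `𝓗^{p-1}`: the element `u` of
`𝓗^{1-p}` is sent to the element `v` of `𝓗^{p-1}` with coordinates `lamⱼ ^ (1-p) uⱼ`, so that the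
inner product `⟨v, w⟩` of `𝓗^{p-1}` equals the duality product `∑ⱼ conj(uⱼ) wⱼ`. -/
def rieszRep (lam : ι → Set.Ioi (0 : ℝ)) (p : ℝ) (u : Sobolev lam (1 - p)) :
    Sobolev lam (p - 1) :=
  ⟨fun j => (((lam j : ℝ) ^ (1 - p) : ℝ) : ℂ) * coord u j, by
    refine (summable_coord u).congr fun j => ?_
    have h0 : 0 < (lam j : ℝ) := (lam j).2
    rw [norm_mul, mul_pow, Complex.norm_real, Real.norm_of_nonneg (Real.rpow_nonneg h0.le _),
      ← mul_assoc, sq ((lam j : ℝ) ^ (1 - p)), ← mul_assoc, ← Real.rpow_add h0]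
    simp⟩

theorem inner_rieszRep (p : ℝ) (u : Sobolev lam (1 - p)) (w : Sobolev lam (p - 1)) :
    ⟪rieszRep lam p u, w⟫_ℂ = ∑' j, star (coord u j) * coord w j := by
  have h : ⟪rieszRep lam p u, w⟫_ℂ = _ :=
    lp.inner_eq_tsum (toL2 lam (p - 1) (rieszRep lam p u)) (toL2 lam (p - 1) w)
  rw [h]
  refine tsum_congr fun j => ?_
  change ⟪(((lam j : ℝ) ^ ((p - 1) / 2) : ℝ) : ℂ) * ((((lam j : ℝ) ^ (1 - p) : ℝ) : ℂ) * coord u j),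
    (((lam j : ℝ) ^ ((p - 1) / 2) : ℝ) : ℂ) * coord w j⟫_ℂ = _
  have h0 : 0 < (lam j : ℝ) := (lam j).2
  have e : (lam j : ℝ) ^ ((p - 1) / 2) * (lam j : ℝ) ^ (1 - p) * (lam j : ℝ) ^ ((p - 1) / 2) = 1 := by
    rw [← Real.rpow_add h0, ← Real.rpow_add h0]
    convert Real.rpow_zero _ using 2
    ring
  have e' : (((lam j : ℝ) ^ ((p - 1) / 2) : ℝ) : ℂ) * (((lam j : ℝ) ^ (1 - p) : ℝ) : ℂ) *
      (((lam j : ℝ) ^ ((p - 1) / 2) : ℝ) : ℂ) = 1 := by exact_mod_cast e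
  rw [RCLike.inner_apply]
  simp only [map_mul, Complex.conj_ofReal, RCLike.star_def]
  linear_combination (starRingEnd ℂ (coord u j) * coord w j) * e'

end Sobolev

/-! ## The Gaussian measure and its density matrices -/

section Gaussian

variable {ι : Type v}

/-- The measure `(l / π) exp(-l |α|²) dα` on `ℂ`. -/
def complexGaussian (l : ℝ) : Measure ℂ :=
  volume.withDensity fun α => ENNReal.ofReal (l / Real.pi * Real.exp (-l * ‖α‖ ^ 2))

/-- The Gaussian measure `dμ₀(u) = ⨂ᵢ (lamᵢ / π) exp(-lamᵢ |αᵢ|²) dαᵢ`, as a measure on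
`𝓗^{1-p}`: the trace on `𝓗^{1-p}` of the product measure on `ι → ℂ`. -/
def gaussianMeasure (lam : ι → Set.Ioi (0 : ℝ)) (p : ℝ) : Measure (Sobolev lam (1 - p)) :=
  (Measure.infinitePi fun i => complexGaussian (lam i)).comap coord

/-- The operator `|u^{⊗k}⟩⟨u^{⊗k}|` from `⨂ₛᵏ 𝓗^{p-1}` to `⨂ₛᵏ 𝓗^{1-p}`, for `u ∈ 𝓗^{1-p}`, where
`⟨u^{⊗k}|` acts on `⨂ₛᵏ 𝓗^{p-1}` through the duality between `𝓗^{1-p}` and `𝓗^{p-1}`. -/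
def ketBra (lam : ι → Set.Ioi (0 : ℝ)) (p : ℝ) (k : ℕ) (u : Sobolev lam (1 - p)) :
    SymPower (Sobolev lam (p - 1)) k →L[ℂ] SymPower (Sobolev lam (1 - p)) k :=
  InnerProductSpace.rankOne ℂ (symPow k u) (symPow k (rieszRep lam p u))

/-- The `k`-particle density matrix `γ₀⁽ᵏ⁾ = ∫ |u^{⊗k}⟩⟨u^{⊗k}| dμ₀(u)`, a Bochner integral in
the space of bounded operators from `⨂ₛᵏ 𝓗^{p-1}` to `⨂ₛᵏ 𝓗^{1-p}`. -/
def densityMatrix (lam : ι → Set.Ioi (0 : ℝ)) (p : ℝ) (k : ℕ) :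
    SymPower (Sobolev lam (p - 1)) k →L[ℂ] SymPower (Sobolev lam (1 - p)) k :=
  ∫ u, ketBra lam p k u ∂(gaussianMeasure lam p)

end Gaussian

end FreeGibbs

end

noncomputable section

namespace FreeGibbs

/-! ### Functional calculus of self-adjoint operators by polynomial approximation -/

section FunctionalCalculus

variable {E : Type u} [NormedAddCommGroup E] [InnerProductSpace ℂ E] [CompleteSpace E]
variable {F : Type v} [NormedAddCommGroup F] [InnerProductSpace ℂ F] [CompleteSpace F]

/-! Under `μ₀` the coordinates are independent rotation-invariant Gaussians with `E|αⱼ|² = 1/λⱼ`.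
Wick's theorem (`integral_prod_coord`) gives `E ∏ α_{g(l)} ∏ conj α_{f(l)} = N ∏ 1/λ_{f(l)}`, where
`N` counts the permutations `σ` with `f ∘ σ = g`. The same `N` appears in the inner product of
`u_{g(1)} ⊗ ⋯ ⊗ u_{g(k)}` with the symmetrised product of the `u_{f(l)}`. Hence the two sides of
`γ₀⁽ᵏ⁾ = k! (h⁻¹)^{⊗k}` have equal matrix elements (`densityMatrix_eq`), which determine a bounded
operator.

Convergence rests on one moment estimate. The integrand has norm `‖u‖^{2k}`, and expanding this
power and applying Hölder gives `E‖u‖^{2k} ≤ k! (∑ λⱼ^{-p})^k` (`lintegral_weightedSq_pow_le`). The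
case `k = 1` also shows that the product measure on sequences is carried by `𝓗^{1-p}`.

The trace bound is computed on the full tensor power, where `(h⁻¹)^{⊗k}` is diagonal in the product
basis and the trace factorises. The symmetric power is a compression of it, and compressing cannot
increase the trace (`posTrace_opPow_symMap_le`).

If `A ≥ 0` and `tr A^p < ∞`, then `A^p = S*S` with `S` Hilbert–Schmidt, so `A^p` and then `A =
(A^p)^{1/p}` are compact. For `A = h⁻¹` this yields the eigenbasis; for `A = k! (h⁻¹)^{⊗k}` it
yields compactness. Uniqueness holds because the first embedding of symmetric powers has dense range
and the second is injective. -/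

theorem exists_spectrum_subset_Icc (A : E →L[ℂ] E) :
    ∃ R : ℝ, ∀ M ≥ R, spectrum ℝ A ⊆ Set.Icc (-M) M := by
  obtain ⟨R, hR⟩ := (spectrum.isCompact (𝕜 := ℝ) A).isBounded.subset_closedBall 0
  refine ⟨R, fun M hM => hR.trans ?_⟩
  rw [Real.closedBall_eq_Icc]
  exact Set.Icc_subset_Icc (by linarith) (by linarith)

theorem norm_cfc_sub_aeval_le {A : E →L[ℂ] E} (hA : IsSelfAdjoint A) {f : ℝ → ℝ}
    (hf : Continuous f) {M ε : ℝ} (hM : spectrum ℝ A ⊆ Set.Icc (-M) M) (hε : 0 ≤ ε)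
    {q : Polynomial ℝ} (hq : ∀ x ∈ Set.Icc (-M) M, |q.eval x - f x| ≤ ε) :
    ‖cfc f A - Polynomial.aeval A q‖ ≤ ε := by
  rw [← cfc_polynomial q A, ← cfc_sub f q.eval A hf.continuousOn q.continuous.continuousOn]
  refine norm_cfc_le hε fun x hx => ?_
  rw [Real.norm_eq_abs, abs_sub_comm]
  exact hq x (hM hx)

omit [CompleteSpace E] [CompleteSpace F] in
theorem comp_aeval_eq {A : E →L[ℂ] E} {B : F →L[ℂ] F} {V : E →L[ℂ] F}
    (h : V ∘L A = B ∘L V) (q : Polynomial ℝ) :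
    V ∘L Polynomial.aeval A q = Polynomial.aeval B q ∘L V := by
  have hpow : ∀ n : ℕ, V ∘L (A ^ n) = (B ^ n) ∘L V := by
    intro n
    induction n with
    | zero => ext x; simp
    | succ n ih =>
      rw [pow_succ, pow_succ]
      ext x
      have h1 := DFunLike.congr_fun ih (A x)
      have h2 := DFunLike.congr_fun h x
      simp only [ContinuousLinearMap.comp_apply, mul_apply_eq_comp] at h1 h2 ⊢
      rw [h1, h2]
  have hpow' : ∀ (n : ℕ) (x : E), V ((A ^ n) x) = (B ^ n) (V x) :=
    fun n x => DFunLike.congr_fun (hpow n) x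
  induction q using Polynomial.induction_on' with
  | add p q hp hq =>
    rw [map_add, map_add, ContinuousLinearMap.comp_add, ContinuousLinearMap.add_comp, hp, hq]
  | monomial n a =>
    rw [Polynomial.aeval_monomial, Polynomial.aeval_monomial, ← Algebra.smul_def,
      ← Algebra.smul_def]
    ext x
    rw [ContinuousLinearMap.comp_apply, ContinuousLinearMap.comp_apply, smul_apply, smul_apply,
      ← hpow' n x, ← Complex.coe_smul, ← Complex.coe_smul, map_smul]

/-- The continuous functional calculus respects intertwining operators. -/
theorem comp_cfc_eq {A : E →L[ℂ] E} {B : F →L[ℂ] F} {V : E →L[ℂ] F}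
    (hA : IsSelfAdjoint A) (hB : IsSelfAdjoint B) (h : V ∘L A = B ∘L V)
    {f : ℝ → ℝ} (hf : Continuous f) : V ∘L cfc f A = cfc f B ∘L V := by
  rw [← sub_eq_zero, ← norm_eq_zero]
  refine le_antisymm (le_of_forall_pos_le_add fun δ hδ => ?_) (norm_nonneg _)
  -- One interval contains both spectra, so a single polynomial approximates `f` for `A` and `B` at
  -- once, and polynomials intertwine.
  obtain ⟨R, hR⟩ := exists_spectrum_subset_Icc A
  obtain ⟨S, hS⟩ := exists_spectrum_subset_Icc B
  set M := max R S
  -- The total error is `2 ε ‖V‖`; the `+ 1` covers `V = 0`.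
  set ε := δ / (2 * (‖V‖ + 1)) with hε
  have hV := norm_nonneg V
  have hε0 : 0 < ε := by positivity
  obtain ⟨q, hq⟩ := exists_polynomial_near_of_continuousOn (-M) M f hf.continuousOn ε hε0
  have h1 := norm_cfc_sub_aeval_le hA hf (hR M (le_max_left _ _)) hε0.le fun x hx => (hq x hx).le
  have h2 := norm_cfc_sub_aeval_le hB hf (hS M (le_max_right _ _)) hε0.le fun x hx => (hq x hx).le
  have e : V ∘L cfc f A - cfc f B ∘L V =
      V ∘L (cfc f A - Polynomial.aeval A q) - (cfc f B - Polynomial.aeval B q) ∘L V := by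
    rw [ContinuousLinearMap.comp_sub, ContinuousLinearMap.sub_comp, comp_aeval_eq h]
    abel
  rw [e, zero_add]
  calc _ ≤ ‖V‖ * ε + ε * ‖V‖ := (norm_sub_le _ _).trans (add_le_add
        ((ContinuousLinearMap.opNorm_comp_le _ _).trans (by gcongr))
        ((ContinuousLinearMap.opNorm_comp_le _ _).trans (by gcongr)))
    _ ≤ δ := by
      have : ε * (2 * (‖V‖ + 1)) = δ := by rw [hε]; field_simp
      nlinarith

/-- The continuous functional calculus acts on eigenvectors through the eigenvalue. -/
theorem cfc_apply_of_eigenvector {A : E →L[ℂ] E} (hA : IsSelfAdjoint A) {f : ℝ → ℝ}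
    (hf : Continuous f) {a : ℝ} {v : E} (hv : A v = (a : ℂ) • v) :
    cfc f A v = (f a : ℂ) • v := by
  have hB : (algebraMap ℝ (ℂ →L[ℂ] ℂ) a) 1 = (a : ℂ) := by
    simp [Algebra.algebraMap_eq_smul_one]
  -- An eigenvector is an intertwiner: `z ↦ z • v` carries multiplication by `a` on `ℂ` to `A`.
  have h := comp_cfc_eq (A := algebraMap ℝ (ℂ →L[ℂ] ℂ) a) (B := A)
    (V := ContinuousLinearMap.toSpanSingleton ℂ v) (.algebraMap _ (.all a)) hA
    (by
      ext
      simp [hv, Algebra.algebraMap_eq_smul_one]) hf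
  have h1 := DFunLike.congr_fun h 1
  rw [cfc_algebraMap] at h1
  simpa [Algebra.algebraMap_eq_smul_one, eq_comm] using h1

/-- A polynomial without constant term in a compact operator is compact, and `f 0 = 0` makes `cfc f
A` a norm limit of such polynomials. -/
theorem isCompactOperator_cfc {A : E →L[ℂ] E} (hA : IsSelfAdjoint A) (hc : IsCompactOperator A)
    {f : ℝ → ℝ} (hf : Continuous f) (hf0 : f 0 = 0) : IsCompactOperator (cfc f A : E →L[ℂ] E) := by
  have hcl : IsClosed {T : E →L[ℂ] E | IsCompactOperator T} := isClosed_setOfPred_isCompactOperator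
  refine hcl.closure_subset (Metric.mem_closure_iff.mpr fun δ hδ => ?_)
  obtain ⟨R, hR⟩ := exists_spectrum_subset_Icc A
  set M := max R 0
  -- Approximation and removal of the constant term `q 0` cost at most `δ / 4` each. Since `M ≥ 0`,
  -- the interval contains `0`, so `q 0` is close to `f 0 = 0`.
  obtain ⟨q, hq⟩ := exists_polynomial_near_of_continuousOn (-M) M f hf.continuousOn (δ / 4)
    (by positivity)
  have hM0 : 0 ≤ M := le_max_right _ _
  have h0 := hq 0 ⟨by linarith, hM0⟩
  rw [hf0, sub_zero, ← Polynomial.coeff_zero_eq_eval_zero] at h0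
  refine ⟨Polynomial.aeval A (q.divX * Polynomial.X), ?_, ?_⟩
  · rw [map_mul, Polynomial.aeval_X]
    exact hc.clm_comp (Polynomial.aeval A q.divX)
  · rw [dist_eq_norm]
    refine (norm_cfc_sub_aeval_le hA hf (hR M (le_max_left _ _)) (by positivity : 0 ≤ δ / 2)
      fun x hx => ?_).trans_lt (by linarith)
    have h1 := hq x hx
    have h2 : q.eval x = (q.divX * Polynomial.X).eval x + q.coeff 0 := by
      conv_lhs => rw [← Polynomial.divX_mul_X_add q]
      simp
    rw [h2] at h1
    rw [abs_lt] at h0 h1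
    rw [abs_le]
    constructor <;> linarith [h0.1, h0.2, h1.1, h1.2]

end FunctionalCalculus

/-! ### Compactness from a finite trace -/

section HilbertSchmidt

variable {E : Type u} [NormedAddCommGroup E] [InnerProductSpace ℂ E]
variable {F : Type v} [NormedAddCommGroup F] [InnerProductSpace ℂ F]
variable {ι : Type*}

/-- The Hilbert–Schmidt norm dominates the operator norm, by Cauchy–Schwarz and Bessel on the
partial sums of the expansion of `x`. -/
theorem norm_le_of_summable_sq (b : HilbertBasis ι ℂ E) (T : E →L[ℂ] F)
    (hT : Summable fun i => ‖T (b i)‖ ^ 2) : ‖T‖ ≤ √(∑' i, ‖T (b i)‖ ^ 2) := by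
  refine T.opNorm_le_bound (Real.sqrt_nonneg _) fun x => ?_
  have h1 : HasSum (fun i => b.repr x i • T (b i)) (T x) := by
    simpa using (b.hasSum_repr x).mapL T
  refine le_of_tendsto h1.norm (Filter.Eventually.of_forall fun s => ?_)
  calc ‖∑ i ∈ s, b.repr x i • T (b i)‖ ≤ ∑ i ∈ s, ‖T (b i)‖ * ‖⟪b i, x⟫_ℂ‖ := by
        refine norm_sum_le_of_le _ fun i _ => ?_
        rw [norm_smul, b.repr_apply_apply, mul_comm]
    _ ≤ √(∑ i ∈ s, ‖T (b i)‖ ^ 2) * √(∑ i ∈ s, ‖⟪b i, x⟫_ℂ‖ ^ 2) :=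
        Real.sum_mul_le_sqrt_mul_sqrt _ _ _
    _ ≤ _ := by
        gcongr
        · exact hT.sum_le_tsum _ fun i _ => by positivity
        · rw [Real.sqrt_le_left (norm_nonneg x)]
          exact b.orthonormal.sum_inner_products_le x

/-- Hilbert–Schmidt operators are compact. -/
theorem isCompactOperator_of_summable_sq [CompleteSpace F] (b : HilbertBasis ι ℂ E)
    (T : E →L[ℂ] F) (hT : Summable fun i => ‖T (b i)‖ ^ 2) : IsCompactOperator T := by
  classical
  have hcl : IsClosed {T : E →L[ℂ] F | IsCompactOperator T} := isClosed_setOfPred_isCompactOperator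
  refine hcl.closure_subset (Metric.mem_closure_iff.mpr fun ε hε => ?_)
  have ht := tendsto_tsum_compl_atTop_zero fun i => ‖T (b i)‖ ^ 2
  -- This tail is the squared Hilbert–Schmidt norm of `T` minus its truncation `S` to the basis
  -- vectors in `s`.
  obtain ⟨s, hs⟩ := (ht.eventually_lt_const (show (0 : ℝ) < ε ^ 2 by positivity)).exists
  set S : E →L[ℂ] F := ∑ i ∈ s, InnerProductSpace.rankOne ℂ (T (b i)) (b i)
  have hS : ∀ i, (T - S) (b i) = if i ∈ s then 0 else T (b i) := by
    intro i
    have : S (b i) = if i ∈ s then T (b i) else 0 := by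
      simp only [S, sum_apply, InnerProductSpace.rankOne_apply,
        orthonormal_iff_ite.mp b.orthonormal]
      simp [ite_smul]
    rw [sub_apply, this]
    split_ifs <;> simp
  refine ⟨S, ?_, ?_⟩
  · have : ∀ i, IsCompactOperator (InnerProductSpace.rankOne ℂ (T (b i)) (b i)) := by
      intro i
      have h1 : IsCompactOperator (innerSL ℂ (b i)) :=
        isCompactOperator_of_locallyCompactSpace_dom (innerSL ℂ (b i))
      exact h1.clm_comp (ContinuousLinearMap.toSpanSingleton ℂ (T (b i)))
    exact Submodule.sum_mem (compactOperator (RingHom.id ℂ) E F) fun i _ => this i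
  · have e : ∀ i, ‖(T - S) (b i)‖ ^ 2 = Set.indicator {i | i ∉ s} (fun i => ‖T (b i)‖ ^ 2) i := by
      intro i
      rw [hS]
      by_cases hi : i ∈ s <;> simp [hi]
    have hsum : Summable fun i => ‖(T - S) (b i)‖ ^ 2 := by
      simp only [e]; exact hT.indicator _
    rw [dist_eq_norm]
    refine (norm_le_of_summable_sq b _ hsum).trans_lt ?_
    rw [Real.sqrt_lt' hε]
    simp only [e]
    rw [← tsum_subtype]
    exact hs

variable [CompleteSpace E]

/-- Factor `B = S*S`: the trace of `B` is the squared Hilbert–Schmidt norm of `S`. -/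
theorem isCompactOperator_of_posTrace_lt_top {B : E →L[ℂ] E} (hB : B.IsPositive)
    (htr : posTrace B < ∞) : IsCompactOperator B := by
  obtain ⟨S, hS⟩ := CStarAlgebra.nonneg_iff_eq_star_mul_self.mp
    ((ContinuousLinearMap.nonneg_iff_isPositive B).mpr hB)
  obtain ⟨w, b, -⟩ := exists_hilbertBasis ℂ E
  have key : ∀ x : E, RCLike.re ⟪x, B x⟫_ℂ = ‖S x‖ ^ 2 := by
    intro x
    rw [hS, ContinuousLinearMap.star_eq_adjoint, mul_apply_eq_comp,
      ContinuousLinearMap.adjoint_inner_right]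
    exact inner_self_eq_norm_sq (𝕜 := ℂ) (S x)
  rw [posTrace_eq_tsum b hB] at htr
  simp only [key] at htr
  have hs : Summable fun i => ‖S (b i)‖ ^ 2 := by
    refine (ENNReal.summable_toReal htr.ne).congr fun i => ?_
    rw [ENNReal.toReal_ofReal (by positivity)]
  rw [hS]
  exact (isCompactOperator_of_summable_sq b S hs).clm_comp (star S)

theorem isPositive_opPow {A : E →L[ℂ] E} (hA : A.IsPositive) {p : ℝ} :
    (opPow A p).IsPositive := by
  rw [← ContinuousLinearMap.nonneg_iff_isPositive] at hA ⊢
  exact cfc_nonneg fun x hx => Real.rpow_nonneg (spectrum_nonneg_of_nonneg hA hx) _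

/-- `A ^ p` is compact by its finite trace, and `A = (A ^ p) ^ (1/p)` is a continuous function of it
vanishing at `0`. -/
theorem isCompactOperator_of_posTrace_opPow_lt_top {A : E →L[ℂ] E} (hA : A.IsPositive) {p : ℝ}
    (hp : 0 < p) (htr : posTrace (opPow A p) < ∞) : IsCompactOperator A := by
  have h1 := isCompactOperator_of_posTrace_lt_top (isPositive_opPow hA) htr
  have hA' : 0 ≤ A := (ContinuousLinearMap.nonneg_iff_isPositive A).mpr hA
  have hcont : ∀ {q : ℝ}, 0 < q → Continuous fun x : ℝ => x ^ q :=
    fun hq => Real.continuous_rpow_const hq.le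
  have h2 := isCompactOperator_cfc (isPositive_opPow hA).isSelfAdjoint h1
    (hcont (inv_pos.mpr hp)) (Real.zero_rpow (inv_pos.mpr hp).ne')
  have h3 : cfc (fun x : ℝ => x ^ p⁻¹) (opPow A p) = A := by
    rw [opPow, ← cfc_comp' (fun x : ℝ => x ^ p⁻¹) (fun x : ℝ => x ^ p) A
      (hcont (inv_pos.mpr hp)).continuousOn (hcont hp).continuousOn hA.isSelfAdjoint]
    conv_rhs => rw [← cfc_id' ℝ A hA.isSelfAdjoint]
    refine cfc_congr fun x hx => ?_
    exact Real.rpow_rpow_inv (spectrum_nonneg_of_nonneg hA' hx) hp.ne'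
  rwa [h3] at h2

end HilbertSchmidt

/-! ### Eigenbases, diagonal operators and their traces -/

section Eigenbasis

variable {E : Type u} [NormedAddCommGroup E] [InnerProductSpace ℂ E] [CompleteSpace E]

/-- A compact self-adjoint operator has an orthonormal basis of eigenvectors. -/
theorem exists_hilbertBasis_eigenvectors {A : E →L[ℂ] E} (hA : IsSelfAdjoint A)
    (hc : IsCompactOperator A) :
    ∃ (ι : Type u) (b : HilbertBasis ι ℂ E) (c : ι → ℂ), ∀ i, A (b i) = c i • b i := by
  have hsym : (A : E →ₗ[ℂ] E).IsSymmetric :=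
    ContinuousLinearMap.isSelfAdjoint_iff_isSymmetric.mp hA
  have hbot := A.orthogonalComplement_iSup_eigenspaces_eq_bot hc hsym
  have hcompl : ∀ μ : ℂ, CompleteSpace (Module.End.eigenspace (A : E →ₗ[ℂ] E) μ) := by
    intro μ
    refine IsClosed.completeSpace_coe (hs := ?_)
    have : (Module.End.eigenspace (A : E →ₗ[ℂ] E) μ : Set E) = {x | A x = μ • x} := by
      ext x; simp
    rw [this]
    exact isClosed_eq A.continuous (continuous_const_smul μ)
  choose w b hb using fun μ : ℂ =>
    exists_hilbertBasis ℂ (Module.End.eigenspace (A : E →ₗ[ℂ] E) μ)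
  -- The bases of all eigenspaces, kernel included, are collected over every `μ : ℂ`; when `μ` is
  -- not an eigenvalue the space is zero and contributes no vector.
  have hon := hsym.orthogonalFamily_eigenspaces.orthonormal_sigma_orthonormal
    (fun μ => (b μ).orthonormal)
  refine ⟨Σ μ : ℂ, w μ, HilbertBasis.mkOfOrthogonalEqBot hon ?_, fun i => i.1, fun i => ?_⟩
  · rw [eq_bot_iff, ← hbot]
    intro x hx
    rw [← Submodule.iInf_orthogonal, Submodule.mem_iInf]
    intro μ
    rw [Submodule.mem_orthogonal]
    intro y hy
    have h0 : (innerSL ℂ x ∘L (Module.End.eigenspace (A : E →ₗ[ℂ] E) μ).subtypeL) = 0 := by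
      refine ContinuousLinearMap.ext_on
        ((Submodule.dense_iff_topologicalClosure_eq_top).mpr (b μ).dense_span) ?_
      rintro _ ⟨i, rfl⟩
      have := hx _ (Submodule.subset_span ⟨⟨μ, i⟩, rfl⟩)
      rw [← inner_conj_symm, map_eq_zero] at this
      simpa using this
    have h1 := DFunLike.congr_fun h0 ⟨y, hy⟩
    rw [← inner_conj_symm, map_eq_zero]
    simpa using h1
  · rw [HilbertBasis.coe_mkOfOrthogonalEqBot]
    exact Module.End.mem_eigenspace_iff.mp (b i.1 i.2).2

/-- Every vector is `x = h (T x)`, so symmetry and non-negativity of `h` at `T x` become those of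
`T` at `x`. -/
theorem IsBoundedInverse.isPositive {h : E →ₗ.[ℂ] E} (hsa : IsSelfAdjoint h)
    (hpos : ∀ x : h.domain, 0 ≤ RCLike.re ⟪(x : E), h x⟫_ℂ) {T : E →L[ℂ] E}
    (hT : IsBoundedInverse h T) : T.IsPositive := by
  have hfa : h.IsFormalAdjoint h := by
    have := LinearPMap.adjoint_isFormalAdjoint hsa.dense_domain
    rwa [LinearPMap.isSelfAdjoint_def.mp hsa] at this
  refine ContinuousLinearMap.isPositive_def.mpr ⟨fun x y => ?_, fun x => ?_⟩
  · obtain ⟨hx, ex⟩ := hT.1 x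
    obtain ⟨hy, ey⟩ := hT.1 y
    have := hfa ⟨T x, hx⟩ ⟨T y, hy⟩
    rw [ex, ey] at this
    exact this.symm
  · obtain ⟨hx, ex⟩ := hT.1 x
    have := hpos ⟨T x, hx⟩
    rw [ex] at this
    rwa [ContinuousLinearMap.reApplyInnerSelf_apply]

omit [CompleteSpace E] in
theorem IsBoundedInverse.apply_eigenbasis {h : E →ₗ.[ℂ] E} {T : E →L[ℂ] E}
    (hT : IsBoundedInverse h T) {ι : Type v} {b : HilbertBasis ι ℂ E} {lam : ι → Set.Ioi (0 : ℝ)}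
    (hb : IsEigenbasis h b lam) (i : ι) : T (b i) = (((lam i : ℝ)⁻¹ : ℝ) : ℂ) • b i := by
  obtain ⟨hi, e⟩ := hb i
  have h1 := hT.2 ⟨b i, hi⟩
  rw [e, map_smul] at h1
  have h0 : ((lam i : ℝ) : ℂ) ≠ 0 := by exact_mod_cast (lam i).2.ne'
  have h2 := congrArg (fun x => ((lam i : ℝ) : ℂ)⁻¹ • x) h1
  simp only [smul_smul, inv_mul_cancel₀ h0, one_smul] at h2
  rw [h2]; push_cast; rfl

/-- `T` is injective because `x = h (T x)`, so its eigenvalues `c i` are strictly positive. Their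
inverses are the eigenvalues of `h`, and `b i = (c i)⁻¹ • T (b i)` lies in the domain. -/
theorem IsBoundedInverse.exists_isEigenbasis {h : E →ₗ.[ℂ] E} {T : E →L[ℂ] E}
    (hT : IsBoundedInverse h T) (hpos : T.IsPositive) (hc : IsCompactOperator T) :
    ∃ (ι : Type u) (b : HilbertBasis ι ℂ E) (lam : ι → Set.Ioi (0 : ℝ)), IsEigenbasis h b lam := by
  obtain ⟨ι, b, c, hb⟩ := exists_hilbertBasis_eigenvectors hpos.isSelfAdjoint hc
  have hinj : ∀ x, T x = 0 → x = 0 := by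
    intro x hx
    obtain ⟨hd, e⟩ := hT.1 x
    rw [← e]
    have : (⟨T x, hd⟩ : h.domain) = 0 := Subtype.ext hx
    rw [this, LinearPMap.map_zero]
  have hin : ∀ i, ⟪b i, T (b i)⟫_ℂ = c i := by
    intro i
    rw [hb, inner_smul_right, inner_self_eq_norm_sq_to_K, b.orthonormal.1 i]
    simp
  have hc0 : ∀ i, 0 < c i := by
    intro i
    refine lt_of_le_of_ne ?_ fun h0 => ?_
    · rw [← hin]; exact hpos.inner_nonneg_right _
    · have h1 : b i = 0 := hinj _ (by rw [hb, ← h0, zero_smul])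
      have h2 := b.orthonormal.1 i
      rw [h1, norm_zero] at h2
      exact zero_ne_one h2
  have hre : ∀ i, 0 < (c i).re ∧ ((c i).re : ℂ) = c i := by
    intro i
    obtain ⟨h1, h2⟩ := Complex.pos_iff.mp (hc0 i)
    exact ⟨h1, Complex.ext rfl (by simpa using h2)⟩
  refine ⟨ι, b, fun i => ⟨((c i).re)⁻¹, inv_pos.mpr (hre i).1⟩, fun i => ?_⟩
  obtain ⟨hd, e⟩ := hT.1 (b i)
  have hcn : c i ≠ 0 := (hc0 i).ne'
  have e1 : (c i)⁻¹ • T (b i) = b i := by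
    rw [hb, smul_smul, inv_mul_cancel₀ hcn, one_smul]
  have hmem : b i ∈ h.domain := by
    rw [← e1]; exact h.domain.smul_mem _ hd
  refine ⟨hmem, ?_⟩
  have e2 : (⟨b i, hmem⟩ : h.domain) = (c i)⁻¹ • ⟨T (b i), hd⟩ := Subtype.ext e1.symm
  rw [e2, LinearPMap.map_smul, e, Complex.ofReal_inv, (hre i).2]

omit [CompleteSpace E] in
-- Both sides are continuous and linear in `x` and agree on `b`. Two different spaces are allowed so
-- that the embeddings of the Sobolev scale are covered.
theorem inner_apply_of_diagonal {F : Type v} [NormedAddCommGroup F] [InnerProductSpace ℂ F]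
    {ι : Type*} (b : HilbertBasis ι ℂ E) (b' : HilbertBasis ι ℂ F) {T : E →L[ℂ] F} {c : ι → ℂ}
    (hT : ∀ i, T (b i) = c i • b' i) (i : ι) (x : E) : ⟪b' i, T x⟫_ℂ = c i * ⟪b i, x⟫_ℂ := by
  classical
  have : innerSL ℂ (b' i) ∘L T = c i • innerSL ℂ (b i) := by
    refine ContinuousLinearMap.ext_on
      ((Submodule.dense_iff_topologicalClosure_eq_top).mpr b.dense_span) ?_
    rintro _ ⟨j, rfl⟩
    simp only [ContinuousLinearMap.comp_apply, innerSL_apply_apply, hT, inner_smul_right,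
      smul_apply, smul_eq_mul, orthonormal_iff_ite.mp b.orthonormal,
      orthonormal_iff_ite.mp b'.orthonormal]
    split_ifs with h
    · rw [h]
    · simp
  exact DFunLike.congr_fun this x

omit [CompleteSpace E] in
theorem isPositive_of_hilbertBasis {ι : Type*} (b : HilbertBasis ι ℂ E) {T : E →L[ℂ] E}
    {c : ι → ℝ} (hc : ∀ i, 0 ≤ c i) (hT : ∀ i, T (b i) = (c i : ℂ) • b i) : T.IsPositive := by
  have hcoord : ∀ i x, ⟪b i, T x⟫_ℂ = c i * ⟪b i, x⟫_ℂ := inner_apply_of_diagonal b b hT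
  have hcoord' : ∀ i x, ⟪T x, b i⟫_ℂ = c i * ⟪x, b i⟫_ℂ := by
    intro i x
    rw [← inner_conj_symm, hcoord, map_mul, Complex.conj_ofReal, inner_conj_symm]
  refine ContinuousLinearMap.isPositive_def.mpr ⟨fun x y => ?_, fun x => ?_⟩
  · change ⟪T x, y⟫_ℂ = ⟪x, T y⟫_ℂ
    rw [← b.tsum_inner_mul_inner, ← b.tsum_inner_mul_inner]
    refine tsum_congr fun i => ?_
    rw [hcoord, hcoord']
    ring
  · rw [ContinuousLinearMap.reApplyInnerSelf_apply]
    have h1 := (b.hasSum_inner_mul_inner (T x) x).mapL RCLike.reCLM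
    refine h1.nonneg fun i => ?_
    rw [hcoord', mul_assoc, ← inner_conj_symm x (b i), RCLike.conj_mul, RCLike.reCLM_apply]
    have : (c i : ℂ) * ((‖⟪b i, x⟫_ℂ‖ : ℂ) ^ 2) = ((c i * ‖⟪b i, x⟫_ℂ‖ ^ 2 : ℝ) : ℂ) := by
      push_cast; rfl
    change 0 ≤ RCLike.re ((c i : ℂ) * ((‖⟪b i, x⟫_ℂ‖ : ℂ) ^ 2))
    rw [this]
    change 0 ≤ (((c i * ‖⟪b i, x⟫_ℂ‖ ^ 2 : ℝ)) : ℝ)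
    exact mul_nonneg (hc i) (by positivity)

omit [CompleteSpace E] in
theorem inner_apply_self_eq_tsum {ι : Type*} (b : HilbertBasis ι ℂ E) {T : E →L[ℂ] E}
    {c : ι → ℝ} (hc : ∀ i, 0 ≤ c i) (hT : ∀ i, T (b i) = (c i : ℂ) • b i) (x : E) :
    ENNReal.ofReal (RCLike.re ⟪x, T x⟫_ℂ) =
      ∑' i, ENNReal.ofReal (c i) * ENNReal.ofReal (‖⟪b i, x⟫_ℂ‖ ^ 2) := by
  have hs : HasSum (fun i => c i * ‖⟪b i, x⟫_ℂ‖ ^ 2) (RCLike.re ⟪x, T x⟫_ℂ) := by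
    have h1 := (b.hasSum_inner_mul_inner x (T x)).mapL RCLike.reCLM
    refine (congrArg (fun f => HasSum f (RCLike.re ⟪x, T x⟫_ℂ)) (funext fun i => ?_)).mp h1
    rw [inner_apply_of_diagonal b b hT, mul_left_comm, ← inner_conj_symm x (b i), RCLike.conj_mul,
      RCLike.reCLM_apply]
    change RCLike.re ((c i : ℂ) * ((‖⟪b i, x⟫_ℂ‖ : ℂ) ^ 2)) = _
    have : (c i : ℂ) * ((‖⟪b i, x⟫_ℂ‖ : ℂ) ^ 2) = ((c i * ‖⟪b i, x⟫_ℂ‖ ^ 2 : ℝ) : ℂ) := by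
      push_cast; rfl
    rw [this]
    exact Complex.ofReal_re _
  rw [← hs.tsum_eq, ENNReal.ofReal_tsum_of_nonneg (fun i => mul_nonneg (hc i) (by positivity))
    hs.summable]
  exact tsum_congr fun i => ENNReal.ofReal_mul (hc i)

/-- Here `B` is `V* T V`. Tonelli and Parseval turn its trace into `∑ⱼ cⱼ ‖V* bⱼ‖²`, and `‖V*‖ ≤ 1`.
-/
theorem posTrace_le_of_compression {K : Type v} [NormedAddCommGroup K] [InnerProductSpace ℂ K]
    [CompleteSpace K] {ι : Type*} (b : HilbertBasis ι ℂ E) {T : E →L[ℂ] E} {c : ι → ℝ}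
    (hc : ∀ i, 0 ≤ c i) (hT : ∀ i, T (b i) = (c i : ℂ) • b i) {V : K →L[ℂ] E} (hV : ‖V‖ ≤ 1)
    {B : K →L[ℂ] K} (hB : ∀ x, ⟪x, B x⟫_ℂ = ⟪V x, T (V x)⟫_ℂ) :
    posTrace B ≤ ∑' i, ENNReal.ofReal (c i) := by
  set d := (exists_hilbertBasis ℂ K).choose_spec.choose with hd
  change ∑' i, ENNReal.ofReal (RCLike.re ⟪d i, B (d i)⟫_ℂ) ≤ _
  simp only [hB, inner_apply_self_eq_tsum b hc hT]
  rw [ENNReal.tsum_comm]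
  refine ENNReal.tsum_le_tsum fun j => ?_
  rw [ENNReal.tsum_mul_left]
  have h1 : ∀ i, ‖⟪b j, V (d i)⟫_ℂ‖ = ‖⟪d i, (ContinuousLinearMap.adjoint V) (b j)⟫_ℂ‖ := by
    intro i
    rw [ContinuousLinearMap.adjoint_inner_right, norm_inner_symm]
  simp only [h1]
  rw [parseval_ennreal d]
  refine (mul_le_mul_right (ENNReal.ofReal_le_one.mpr ?_) _).trans_eq (mul_one _)
  refine pow_le_one₀ (norm_nonneg _) ?_
  refine (ContinuousLinearMap.le_opNorm _ _).trans ?_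
  rw [b.orthonormal.1 j, mul_one, LinearIsometryEquiv.norm_map]
  exact hV

theorem posTrace_opPow_eq {ι : Type*} (b : HilbertBasis ι ℂ E) {T : E →L[ℂ] E} (hp : T.IsPositive)
    {c : ι → ℝ} (hT : ∀ i, T (b i) = (c i : ℂ) • b i) {p : ℝ}
    (hp0 : 0 ≤ p) : posTrace (opPow T p) = ∑' i, ENNReal.ofReal (c i ^ p) := by
  rw [posTrace_eq_tsum b (isPositive_opPow hp)]
  refine tsum_congr fun i => ?_
  rw [opPow, cfc_apply_of_eigenvector hp.isSelfAdjoint (Real.continuous_rpow_const hp0) (hT i),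
    inner_smul_right, inner_self_eq_norm_sq_to_K, b.orthonormal.1 i]
  simp

end Eigenbasis

/-- Factorises both the trace over a product basis and the moment bound for the Gaussian measure. -/
theorem tsum_prod_eq_pow {ι : Type*} (x : ι → ℝ≥0∞) (k : ℕ) :
    ∑' f : Fin k → ι, ∏ l, x (f l) = (∑' i, x i) ^ k := by
  induction k with
  | zero => simp
  | succ k ih =>
    rw [← (Fin.consEquiv fun _ : Fin (k + 1) => ι).tsum_eq, ENNReal.tsum_prod', pow_succ', ← ih,
      ← ENNReal.tsum_mul_right]
    refine tsum_congr fun i => ?_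
    rw [← ENNReal.tsum_mul_left]
    refine tsum_congr fun f => ?_
    simp [Fin.prod_univ_succ, Fin.consEquiv]

/-! ### Product bases of tensor powers and density of symmetrised products -/

section

variable {E : Type u} [NormedAddCommGroup E] [InnerProductSpace ℂ E]
variable {F : Type v} [NormedAddCommGroup F] [InnerProductSpace ℂ F]
variable {ι : Type*} {k : ℕ}

theorem eq_zero_of_inner_eq_zero {S : Set E} [CompleteSpace E]
    (hS : (Submodule.span ℂ S).topologicalClosure = ⊤) {v : E} (h : ∀ s ∈ S, ⟪s, v⟫_ℂ = 0) :
    v = 0 := by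
  rw [Submodule.topologicalClosure_eq_top_iff] at hS
  rw [← Submodule.mem_bot ℂ, ← hS, Submodule.mem_orthogonal]
  intro u hu
  induction hu using Submodule.span_induction with
  | mem x hx => exact h x hx
  | zero => exact inner_zero_left _
  | add x y _ _ hx hy => rw [inner_add_left, hx, hy, add_zero]
  | smul a x _ hx => rw [inner_smul_left, hx, mul_zero]

/-- `PreTensor` is free on tuples, so multilinearity appears only after separation. Identities such
as `tensor_smul` are therefore checked by pairing with elementary tensors. -/
theorem tensorPower_ext {v w : TensorPower E k}
    (h : ∀ x : Fin k → E, ⟪tensor x, v⟫_ℂ = ⟪tensor x, w⟫_ℂ) : v = w := by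
  rw [← sub_eq_zero]
  refine eq_zero_of_inner_eq_zero (dense_span_tensor k) ?_
  rintro _ ⟨x, rfl⟩
  rw [inner_sub_right, h, sub_self]

theorem norm_tensor (x : Fin k → E) : ‖tensor x‖ = ∏ l, ‖x l‖ := by
  have h : ((‖tensor x‖ ^ 2 : ℝ) : ℂ) = (((∏ l, ‖x l‖) ^ 2 : ℝ) : ℂ) := by
    have := inner_self_eq_norm_sq_to_K (𝕜 := ℂ) (tensor x)
    rw [inner_tensor] at this
    push_cast
    refine this.symm.trans ?_
    rw [← Finset.prod_pow]
    exact Finset.prod_congr rfl fun l _ => inner_self_eq_norm_sq_to_K (𝕜 := ℂ) (x l)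
  exact (sq_eq_sq₀ (norm_nonneg _) (Finset.prod_nonneg fun _ _ => norm_nonneg _)).mp
    (Complex.ofReal_injective h)

theorem tensor_smul (c : Fin k → ℂ) (x : Fin k → E) :
    tensor (fun l => c l • x l) = (∏ l, c l) • tensor x := by
  refine tensorPower_ext fun z => ?_
  simp only [inner_tensor, inner_smul_right, Finset.prod_mul_distrib]

theorem inner_tensor_update (z x : Fin k → E) (l : Fin k) (y : E) :
    ⟪tensor z, tensor (Function.update x l y)⟫_ℂ =
      ⟪z l, y⟫_ℂ * ∏ i ∈ Finset.univ.erase l, ⟪z i, x i⟫_ℂ := by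
  rw [inner_tensor, ← Finset.mul_prod_erase _ _ (Finset.mem_univ l), Function.update_self]
  congr 1
  refine Finset.prod_congr rfl fun i hi => ?_
  rw [Function.update_of_ne (Finset.ne_of_mem_erase hi)]

/-- The tensor `x₁ ⊗ ⋯ ⊗ y ⊗ ⋯ ⊗ xₖ` as a function of the factor `y` in position `l`. -/
def tensorSlot (x : Fin k → E) (l : Fin k) : E →L[ℂ] TensorPower E k :=
  LinearMap.mkContinuous
    { toFun := fun y => tensor (Function.update x l y)
      map_add' := fun y z => tensorPower_ext fun w => by
        simp only [inner_add_right, inner_tensor_update, add_mul]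
      map_smul' := fun a y => tensorPower_ext fun w => by
        simp only [inner_smul_right, inner_tensor_update, RingHom.id_apply, mul_assoc] }
    (∏ i ∈ Finset.univ.erase l, ‖x i‖) fun y => by
      change ‖tensor (Function.update x l y)‖ ≤ _
      rw [norm_tensor, ← Finset.mul_prod_erase _ _ (Finset.mem_univ l), Function.update_self,
        mul_comm]
      refine le_of_eq (congrArg (· * ‖y‖) (Finset.prod_congr rfl fun i hi => ?_))
      rw [Function.update_of_ne (Finset.ne_of_mem_erase hi)]

theorem tensorSlot_apply (x : Fin k → E) (l : Fin k) (y : E) :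
    tensorSlot x l y = tensor (Function.update x l y) := rfl

/-- Basis vectors are replaced by arbitrary ones a slot at a time, by continuity in that slot and
density of the span of `b`; the induction is on the set of freed slots. -/
theorem inner_tensor_eq_zero_of_basis (b : HilbertBasis ι ℂ E) {v : TensorPower E k}
    (h : ∀ f : Fin k → ι, ⟪v, tensor fun l => b (f l)⟫_ℂ = 0) (x : Fin k → E) :
    ⟪v, tensor x⟫_ℂ = 0 := by
  have key : ∀ (S : Finset (Fin k)) (x : Fin k → E), (∀ l ∉ S, ∃ j, x l = b j) →
      ⟪v, tensor x⟫_ℂ = 0 := by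
    intro S
    induction S using Finset.induction_on with
    | empty =>
      intro x hx
      choose f hf using fun l => hx l (Finset.notMem_empty l)
      rw [funext hf]
      exact h f
    | insert a S ha ih =>
      intro x hx
      have h0 : innerSL ℂ v ∘L tensorSlot x a = 0 := by
        refine ContinuousLinearMap.ext_on
          ((Submodule.dense_iff_topologicalClosure_eq_top).mpr b.dense_span) ?_
        rintro _ ⟨j, rfl⟩
        refine ih (Function.update x a (b j)) fun l hl => ?_
        by_cases hla : l = a
        · exact ⟨j, by rw [hla, Function.update_self]⟩
        · rw [Function.update_of_ne hla]
          exact hx l (by simp [hla, hl])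
      have h1 := DFunLike.congr_fun h0 (x a)
      rwa [ContinuousLinearMap.comp_apply, tensorSlot_apply, Function.update_eq_self] at h1
  exact key Finset.univ x fun l hl => absurd (Finset.mem_univ l) hl

theorem inner_tensor_basis [DecidableEq ι] (b : HilbertBasis ι ℂ E) (f g : Fin k → ι) :
    ⟪tensor (fun l => b (f l)), tensor fun l => b (g l)⟫_ℂ = if f = g then 1 else 0 := by
  rw [inner_tensor]
  simp only [orthonormal_iff_ite.mp b.orthonormal, Finset.prod_ite_zero, Finset.prod_const_one,
    funext_iff, Finset.mem_univ, forall_const]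

/-- The orthonormal basis of `⨂ᵏ E` that consists of the tensor products of the elements of an
orthonormal basis of `E`. -/
def tensorBasis (b : HilbertBasis ι ℂ E) (k : ℕ) : HilbertBasis (Fin k → ι) ℂ (TensorPower E k) :=
  HilbertBasis.mkOfOrthogonalEqBot (v := fun f : Fin k → ι => tensor fun l => b (f l))
    (by
      classical
      exact orthonormal_iff_ite.mpr fun f g => inner_tensor_basis b f g)
    (by
      rw [eq_bot_iff]
      intro v hv
      rw [Submodule.mem_bot]
      refine tensorPower_ext fun x => ?_
      rw [inner_zero_right, ← inner_conj_symm, map_eq_zero]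
      refine inner_tensor_eq_zero_of_basis b (fun f => ?_) x
      rw [← inner_conj_symm, map_eq_zero]
      exact hv _ (Submodule.subset_span ⟨f, rfl⟩))

theorem tensorBasis_apply (b : HilbertBasis ι ℂ E) (f : Fin k → ι) :
    tensorBasis b k f = tensor fun l => b (f l) := by
  rw [tensorBasis, HilbertBasis.coe_mkOfOrthogonalEqBot]

theorem tensorMap_tensorBasis (b : HilbertBasis ι ℂ E) (b' : HilbertBasis ι ℂ F) {T : E →L[ℂ] F}
    {c : ι → ℂ} (hT : ∀ i, T (b i) = c i • b' i) (f : Fin k → ι) :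
    tensorMap k T (tensorBasis b k f) = (∏ l, c (f l)) • tensorBasis b' k f := by
  simp only [tensorBasis_apply, tensorMap_tensor, hT, tensor_smul]

/-! ### Symmetric tensors -/

/-- The symmetric tensor product, as an element of `⨂ₛᵏ E`. -/
def symTensor (x : Fin k → E) : SymPower E k :=
  ⟨symProd x, Submodule.le_topologicalClosure _ (Submodule.subset_span ⟨x, rfl⟩)⟩

theorem symIncl_symTensor (x : Fin k → E) : symIncl E k (symTensor x) = symProd x := rfl

theorem symIncl_symPow (x : E) : symIncl E k (symPow k x) = tensor fun _ => x := rfl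

theorem symIncl_injective (E : Type u) [NormedAddCommGroup E] [InnerProductSpace ℂ E]
    (k : ℕ) : Function.Injective (symIncl E k) := Subtype.val_injective

theorem inner_symIncl (s t : SymPower E k) : ⟪symIncl E k s, symIncl E k t⟫_ℂ = ⟪s, t⟫_ℂ := rfl

theorem norm_symIncl_le : ‖symIncl E k‖ ≤ 1 := (symSubspace E k).norm_subtypeL_le

theorem symMap_symTensor (A : E →L[ℂ] F) (x : Fin k → E) :
    symMap k A (symTensor x) = symTensor fun l => A (x l) :=
  symIncl_injective F k (tensorMap_symProd A x)

theorem symTensor_smul (c : Fin k → ℂ) (x : Fin k → E) :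
    symTensor (fun l => c l • x l) = (∏ l, c l) • symTensor x := by
  refine symIncl_injective E k ?_
  rw [map_smul, symIncl_symTensor, symIncl_symTensor, symProd, symProd, smul_comm]
  refine congrArg _ ?_
  rw [Finset.smul_sum]
  refine Finset.sum_congr rfl fun σ _ => ?_
  rw [tensor_smul (fun l => c (σ l)) fun l => x (σ l), Equiv.prod_comp σ c]

theorem inner_tensor_symProd (x y : Fin k → E) :
    ⟪tensor x, symProd y⟫_ℂ =
      (((√(k ! : ℝ))⁻¹ : ℝ) : ℂ) * ∑ σ : Equiv.Perm (Fin k), ∏ l, ⟪x l, y (σ l)⟫_ℂ := by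
  simp only [symProd, inner_smul_right, inner_sum, inner_tensor]

/-- On a symmetrised product this is a reindexing of the sum over permutations. The equality locus
of two continuous functionals is closed, so it extends to `SymPower`. -/
theorem inner_tensor_perm (σ : Equiv.Perm (Fin k)) (x : Fin k → E) (t : SymPower E k) :
    ⟪tensor (fun l => x (σ l)), symIncl E k t⟫_ℂ = ⟪tensor x, symIncl E k t⟫_ℂ := by
  have hle : symSubspace E k ≤ LinearMap.eqLocus
      (innerSL ℂ (tensor fun l => x (σ l)) : TensorPower E k →ₗ[ℂ] ℂ)
      (innerSL ℂ (tensor x) : TensorPower E k →ₗ[ℂ] ℂ) := by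
    refine Submodule.topologicalClosure_minimal _ ?_
      (isClosed_eq (innerSL ℂ (tensor fun l => x (σ l))).continuous
        (innerSL ℂ (tensor x)).continuous)
    rw [Submodule.span_le]
    rintro _ ⟨y, rfl⟩
    change ⟪tensor (fun l => x (σ l)), symProd y⟫_ℂ = ⟪tensor x, symProd y⟫_ℂ
    rw [inner_tensor_symProd, inner_tensor_symProd]
    congr 1
    rw [← Equiv.sum_comp (Equiv.mulRight σ)]
    refine Finset.sum_congr rfl fun τ _ => ?_
    exact Equiv.prod_comp σ fun l => ⟪x l, y (τ l)⟫_ℂ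
  exact hle (Subtype.property (p := (· ∈ symSubspace E k)) t)

/-- By permutation invariance the `k!` terms of the symmetrisation coincide, and `k! / √k! = √k!`.
-/
theorem inner_symTensor (x : Fin k → E) (t : SymPower E k) :
    ⟪symTensor x, t⟫_ℂ = ((√(k ! : ℝ) : ℝ) : ℂ) * ⟪tensor x, symIncl E k t⟫_ℂ := by
  rw [← inner_symIncl, symIncl_symTensor, symProd, inner_smul_left, sum_inner]
  simp only [inner_tensor_perm, Finset.sum_const, Finset.card_univ, Fintype.card_perm,
    Fintype.card_fin, nsmul_eq_mul, Complex.conj_ofReal]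
  rw [← mul_assoc]
  congr 1
  have hk : (0 : ℝ) < k ! := by positivity
  have : (√(k ! : ℝ))⁻¹ * (k ! : ℝ) = √(k ! : ℝ) := by
    rw [inv_mul_eq_iff_eq_mul₀ (by positivity), Real.mul_self_sqrt hk.le]
  exact_mod_cast congrArg (fun r : ℝ => (r : ℂ)) this

theorem symPower_ext (b : HilbertBasis ι ℂ E) {v w : SymPower E k}
    (h : ∀ f : Fin k → ι, ⟪tensor (fun l => b (f l)), symIncl E k v⟫_ℂ =
      ⟪tensor (fun l => b (f l)), symIncl E k w⟫_ℂ) : v = w := by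
  refine symIncl_injective E k ((tensorBasis b k).repr.injective (lp.ext (funext fun f => ?_)))
  rw [HilbertBasis.repr_apply_apply, HilbertBasis.repr_apply_apply, tensorBasis_apply]
  exact h f

/-- By `inner_symTensor`, a symmetric tensor orthogonal to the symmetrised basis products is
orthogonal to the whole product basis. -/
theorem dense_span_symTensor (b : HilbertBasis ι ℂ E) (k : ℕ) :
    Dense (Submodule.span ℂ (Set.range fun f : Fin k → ι => symTensor fun l => b (f l)) :
      Set (SymPower E k)) := by
  rw [Submodule.dense_iff_topologicalClosure_eq_top, Submodule.topologicalClosure_eq_top_iff,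
    eq_bot_iff]
  intro v hv
  rw [Submodule.mem_bot]
  refine symPower_ext b fun f => ?_
  have h1 : ⟪symTensor (fun l => b (f l)), v⟫_ℂ = 0 := hv _ (Submodule.subset_span ⟨f, rfl⟩)
  rw [inner_symTensor] at h1
  have hk : ((√(k ! : ℝ) : ℝ) : ℂ) ≠ 0 := by
    have : (0 : ℝ) < √(k ! : ℝ) := by positivity
    exact_mod_cast this.ne'
  rw [map_zero, inner_zero_right]
  exact (mul_eq_zero.mp h1).resolve_left hk

variable {b : HilbertBasis ι ℂ E} {b' : HilbertBasis ι ℂ F} {T : E →L[ℂ] F} {c : ι → ℂ}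

theorem symMap_symTensor_basis (hT : ∀ i, T (b i) = c i • b' i) (f : Fin k → ι) :
    symMap k T (symTensor fun l => b (f l)) =
      (∏ l, c (f l)) • symTensor fun l => b' (f l) := by
  simp only [symMap_symTensor, hT, symTensor_smul]

/-- Coordinates in the product basis are multiplied by the nonzero numbers `∏ c (f l)`. This cancels
the embedding on the left in the uniqueness claim. -/
theorem symMap_injective_of_diagonal (hT : ∀ i, T (b i) = c i • b' i) (hc : ∀ i, c i ≠ 0) :
    Function.Injective (symMap k T) := by
  intro s t hst
  refine symPower_ext b fun f => ?_
  have h1 : ∀ r : SymPower E k, ⟪tensorBasis b' k f, symIncl F k (symMap k T r)⟫_ℂ =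
      (∏ l, c (f l)) * ⟪tensorBasis b k f, symIncl E k r⟫_ℂ := fun r =>
    inner_apply_of_diagonal (tensorBasis b k) (tensorBasis b' k)
      (tensorMap_tensorBasis b b' hT) f (symIncl E k r)
  have h2 := h1 s
  rw [hst, h1 t] at h2
  rw [← tensorBasis_apply]
  exact (mul_left_cancel₀ (Finset.prod_ne_zero_iff.mpr fun l _ => hc (f l)) h2).symm

/-- The range of `symMap k T` contains nonzero multiples of all symmetrised basis products, hence is
dense. This cancels the embedding on the right. -/
theorem eq_of_comp_symMap_eq {G : Type*} [NormedAddCommGroup G] [NormedSpace ℂ G]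
    (hT : ∀ i, T (b i) = c i • b' i) (hc : ∀ i, c i ≠ 0) {A B : SymPower F k →L[ℂ] G}
    (h : A ∘L symMap k T = B ∘L symMap k T) : A = B := by
  refine ContinuousLinearMap.ext_on (dense_span_symTensor b' k) ?_
  rintro _ ⟨f, rfl⟩
  have h1 := DFunLike.congr_fun h (symTensor fun l => b (f l))
  simp only [ContinuousLinearMap.comp_apply, symMap_symTensor_basis hT, map_smul] at h1
  exact smul_right_injective _ (Finset.prod_ne_zero_iff.mpr fun l _ => hc (f l)) h1

end

/-! ### The trace bound on the symmetric power -/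

section Trace

variable {E : Type u} [NormedAddCommGroup E] [InnerProductSpace ℂ E]
variable {ι : Type*} {b : HilbertBasis ι ℂ E} {T : E →L[ℂ] E} {a : ι → ℝ}

theorem smul_tensorMap_tensorBasis (hT : ∀ i, T (b i) = (a i : ℂ) • b i) (k : ℕ) (r : ℝ)
    (f : Fin k → ι) : ((r : ℂ) • tensorMap k T) (tensorBasis b k f) =
      ((r * ∏ l, a (f l) : ℝ) : ℂ) • tensorBasis b k f := by
  rw [smul_apply, tensorMap_tensorBasis b b hT, smul_smul]
  push_cast
  rfl

theorem isPositive_smul_tensorMap (ha : ∀ i, 0 ≤ a i) (hT : ∀ i, T (b i) = (a i : ℂ) • b i)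
    (k : ℕ) {r : ℝ} (hr : 0 ≤ r) : ((r : ℂ) • tensorMap k T).IsPositive :=
  isPositive_of_hilbertBasis (tensorBasis b k)
    (fun f => mul_nonneg hr (Finset.prod_nonneg fun l _ => ha (f l)))
    (smul_tensorMap_tensorBasis hT k r)

theorem isPositive_smul_symMap (ha : ∀ i, 0 ≤ a i) (hT : ∀ i, T (b i) = (a i : ℂ) • b i)
    (k : ℕ) {r : ℝ} (hr : 0 ≤ r) : ((r : ℂ) • symMap k T).IsPositive := by
  have h := ContinuousLinearMap.isPositive_def.mp (isPositive_smul_tensorMap ha hT k hr)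
  exact ContinuousLinearMap.isPositive_def.mpr
    ⟨fun s t => h.1 (symIncl E k s) (symIncl E k t), fun s => h.2 (symIncl E k s)⟩

/-- The inclusion of `⨂ₛᵏ E` intertwines the symmetric operator with the full one, hence also their
`p`-th powers. The symmetric trace is then bounded by the full one, which factorises, and no
eigenbasis of the symmetric power is needed. -/
theorem posTrace_opPow_symMap_le (ha : ∀ i, 0 ≤ a i)
    (hT : ∀ i, T (b i) = (a i : ℂ) • b i) (k : ℕ) {r : ℝ} (hr : 0 ≤ r) {p : ℝ} (hp : 0 ≤ p) :
    posTrace (opPow ((r : ℂ) • symMap k T) p) ≤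
      ENNReal.ofReal (r ^ p) * (∑' i, ENNReal.ofReal (a i ^ p)) ^ k := by
  have hf : Continuous fun x : ℝ => x ^ p := Real.continuous_rpow_const hp
  have hS := (isPositive_smul_symMap ha hT k hr).isSelfAdjoint
  have hP := (isPositive_smul_tensorMap ha hT k hr).isSelfAdjoint
  have hi := comp_cfc_eq (V := symIncl E k) hS hP (by ext t; rfl) hf
  have h1 := posTrace_le_of_compression (tensorBasis b k)
    (T := opPow ((r : ℂ) • tensorMap k T) p) (c := fun f => (r * ∏ l, a (f l)) ^ p)
    (fun f => Real.rpow_nonneg (mul_nonneg hr (Finset.prod_nonneg fun l _ => ha (f l))) _)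
    (fun f => cfc_apply_of_eigenvector hP hf (smul_tensorMap_tensorBasis hT k r f))
    (V := symIncl E k) norm_symIncl_le (B := opPow ((r : ℂ) • symMap k T) p) (fun t => by
      rw [← inner_symIncl]
      exact congrArg _ (DFunLike.congr_fun hi t))
  refine h1.trans_eq ?_
  rw [← tsum_prod_eq_pow, ← ENNReal.tsum_mul_left]
  refine tsum_congr fun f => ?_
  rw [Real.mul_rpow hr (Finset.prod_nonneg fun l _ => ha (f l)),
    ENNReal.ofReal_mul (Real.rpow_nonneg hr _), ← Real.finsetProd_rpow _ _ fun l _ => ha (f l),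
    ENNReal.ofReal_prod_of_nonneg fun l _ => Real.rpow_nonneg (ha (f l)) _]

end Trace

/-! ### Moments of a complex Gaussian -/

section OneDimensional

variable {l : ℝ}

theorem integral_complexGaussian (hl : 0 < l) (g : ℂ → ℂ) :
    ∫ z, g z ∂(complexGaussian l) =
      ∫ z, ((l / Real.pi * Real.exp (-l * ‖z‖ ^ 2) : ℝ) : ℂ) * g z := by
  rw [complexGaussian, integral_withDensity_eq_integral_toReal_smul (by fun_prop)
    (Filter.Eventually.of_forall fun _ => ENNReal.ofReal_lt_top)]
  refine integral_congr_ae (Filter.Eventually.of_forall fun z => ?_)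
  have : 0 ≤ l / Real.pi * Real.exp (-l * ‖z‖ ^ 2) := by positivity
  simp only [ENNReal.toReal_ofReal this, Complex.real_smul]

theorem integral_norm_pow_mul_gaussian (hl : 0 < l) (n : ℕ) :
    ∫ z : ℂ, l / Real.pi * Real.exp (-l * ‖z‖ ^ 2) * ‖z‖ ^ (2 * n) = n ! * l⁻¹ ^ n := by
  have h := Complex.integral_rpow_mul_exp_neg_mul_rpow (p := 2) (q := ((2 * n : ℕ) : ℝ)) (b := l)
    (by norm_num) (by have : (0 : ℝ) ≤ ((2 * n : ℕ) : ℝ) := Nat.cast_nonneg _; linarith) hl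
  simp only [Real.rpow_natCast, Real.rpow_ofNat] at h
  have e : ∀ z : ℂ, l / Real.pi * Real.exp (-l * ‖z‖ ^ 2) * ‖z‖ ^ (2 * n) =
      l / Real.pi * (‖z‖ ^ (2 * n) * Real.exp (-l * ‖z‖ ^ 2)) := fun z => by ring
  simp only [e]
  rw [integral_const_mul, h]
  have e1 : (((2 * n : ℕ) : ℝ) + 2) / 2 = n + 1 := by push_cast; ring
  have e2 : -(((2 * n : ℕ) : ℝ) + 2) / 2 = -((n + 1 : ℕ) : ℝ) := by push_cast; ring
  rw [e1, e2, Real.Gamma_nat_eq_factorial, Real.rpow_neg hl.le, Real.rpow_natCast, inv_pow, pow_succ]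
  have := Real.pi_pos.ne'
  field_simp

theorem lintegral_norm_pow_complexGaussian (hl : 0 < l) (n : ℕ) :
    ∫⁻ z, ENNReal.ofReal (‖z‖ ^ 2) ^ n ∂(complexGaussian l) =
      ENNReal.ofReal (n ! * l⁻¹ ^ n) := by
  have h := integral_norm_pow_mul_gaussian hl n
  have hint : Integrable fun z : ℂ =>
      l / Real.pi * Real.exp (-l * ‖z‖ ^ 2) * ‖z‖ ^ (2 * n) := by
    -- A non-integrable function has Bochner integral `0`, whereas the value in `h` is positive.
    by_contra hn
    rw [integral_undef hn] at h
    have : 0 < n ! * l⁻¹ ^ n := by positivity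
    exact this.ne h
  rw [← h, ofReal_integral_eq_lintegral_ofReal hint
    (Filter.Eventually.of_forall fun z => by positivity), complexGaussian,
    lintegral_withDensity_eq_lintegral_mul _ (by fun_prop) (by fun_prop)]
  refine lintegral_congr fun z => ?_
  rw [Pi.mul_apply, ← ENNReal.ofReal_pow (by positivity), ← ENNReal.ofReal_mul (by positivity),
    pow_mul]

theorem isProbabilityMeasure_complexGaussian (hl : 0 < l) :
    IsProbabilityMeasure (complexGaussian l) := by
  refine ⟨?_⟩
  simpa using lintegral_norm_pow_complexGaussian hl 0

/-- Rotation by the angle `π / (m - n)` preserves the weight and multiplies `z ^ m * conj z ^ n` by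
`-1`, so the integral is its own negative. -/
theorem integral_pow_mul_conj_pow_of_ne (hl : 0 < l) {m n : ℕ} (hmn : m ≠ n) :
    ∫ z, z ^ m * (starRingEnd ℂ z) ^ n ∂(complexGaussian l) = 0 := by
  rw [integral_complexGaussian hl]
  set F : ℂ → ℂ := fun z =>
    ((l / Real.pi * Real.exp (-l * ‖z‖ ^ 2) : ℝ) : ℂ) * (z ^ m * (starRingEnd ℂ z) ^ n) with hF
  have hmn' : (m : ℝ) - n ≠ 0 := sub_ne_zero.mpr (Nat.cast_injective.ne hmn)
  set θ : ℝ := Real.pi / (m - n)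
  set c : Circle := Circle.exp θ
  have hc : (c : ℂ) ^ m * (starRingEnd ℂ (c : ℂ)) ^ n = -1 := by
    have h1 : (c : ℂ) = Complex.exp (θ * Complex.I) := Circle.coe_exp θ
    have h2 : starRingEnd ℂ (c : ℂ) = Complex.exp (-(θ * Complex.I)) := by
      rw [h1, ← Complex.exp_conj]; simp
    rw [h2, h1, ← Complex.exp_nat_mul, ← Complex.exp_nat_mul, ← Complex.exp_add,
      ← Complex.exp_pi_mul_I]
    congr 1
    have : ((θ * (m - n) : ℝ) : ℂ) = (Real.pi : ℂ) := by
      rw [div_mul_cancel₀ _ hmn']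
    push_cast at this
    linear_combination Complex.I * this
  have hrot := (rotation c).measurePreserving.integral_comp
    (rotation c).toHomeomorph.measurableEmbedding F
  have e : ∀ z, F (rotation c z) = -F z := by
    intro z
    simp only [hF, rotation_apply, norm_mul, Circle.norm_coe, one_mul, mul_pow, map_mul]
    linear_combination ((l / Real.pi * Real.exp (-l * ‖z‖ ^ 2) : ℝ) : ℂ) *
      (z ^ m * (starRingEnd ℂ z) ^ n) * hc
  simp only [e, integral_neg] at hrot
  exact self_eq_neg.mp hrot.symm

theorem integral_pow_mul_conj_pow (hl : 0 < l) (m n : ℕ) :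
    ∫ z, z ^ m * (starRingEnd ℂ z) ^ n ∂(complexGaussian l) =
      if m = n then (n ! : ℂ) * ((l⁻¹ : ℝ) : ℂ) ^ n else 0 := by
  split_ifs with h
  · rw [h, integral_complexGaussian hl]
    have e : ∀ z : ℂ, ((l / Real.pi * Real.exp (-l * ‖z‖ ^ 2) : ℝ) : ℂ) *
        (z ^ n * (starRingEnd ℂ z) ^ n) =
        ((l / Real.pi * Real.exp (-l * ‖z‖ ^ 2) * ‖z‖ ^ (2 * n) : ℝ) : ℂ) := by
      intro z
      rw [← mul_pow, Complex.mul_conj, Complex.normSq_eq_norm_sq]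
      push_cast
      ring
    simp only [e]
    rw [integral_complex_ofReal, integral_norm_pow_mul_gaussian hl]
    push_cast
    rfl
  · exact integral_pow_mul_conj_pow_of_ne hl h

end OneDimensional

/-! ### Counting permutations that carry one multi-index to another -/

section Fibers

variable {α ι : Type*} [Fintype α] [DecidableEq α] [Fintype ι] [DecidableEq ι]

omit [DecidableEq α] [Fintype ι] in
theorem exists_perm_comp_eq {f g : α → ι}
    (h : ∀ i, Fintype.card {a // g a = i} = Fintype.card {a // f a = i}) :
    ∃ σ : Equiv.Perm α, ∀ a, f (σ a) = g a := by
  refine ⟨(Equiv.sigmaFiberEquiv g).symm.trans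
    ((Equiv.sigmaCongrRight fun i => Fintype.equivOfCardEq (h i)).trans
      (Equiv.sigmaFiberEquiv f)), fun a => ?_⟩
  exact (Fintype.equivOfCardEq (h (g a)) ⟨a, rfl⟩).2

/-- The number of permutations that transform one function into another. -/
theorem card_perm_comp_eq (f g : α → ι)
    [DecidablePred fun σ : Equiv.Perm α => ∀ a, f (σ a) = g a] :
    (Finset.univ.filter fun σ : Equiv.Perm α => ∀ a, f (σ a) = g a).card =
      ∏ i, if Fintype.card {a // g a = i} = Fintype.card {a // f a = i} then
        (Fintype.card {a // f a = i})! else 0 := by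
  by_cases h : ∀ i, Fintype.card {a // g a = i} = Fintype.card {a // f a = i}
  · simp only [h, if_true]
    obtain ⟨σ, hσ⟩ := exists_perm_comp_eq h
    -- The permutations in question form a coset, through `σ`, of the stabiliser of `f`, whose order
    -- is the product of the factorials of the fibre sizes.
    rw [← DomMulAct.stabilizer_card, Fintype.card_subtype]
    refine Finset.card_bij (fun τ _ => τ * σ⁻¹) (fun τ hτ => ?_) (fun τ _ τ' _ e => by simpa using e)
      fun ρ hρ => ⟨ρ * σ, ?_, by simp⟩
    · rw [Finset.mem_filter] at hτ ⊢
      refine ⟨Finset.mem_univ _, funext fun a => ?_⟩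
      have h1 := hτ.2 (σ⁻¹ a)
      rw [← hσ] at h1
      simpa using h1
    · rw [Finset.mem_filter] at hρ ⊢
      refine ⟨Finset.mem_univ _, fun a => ?_⟩
      have h1 := congrFun hρ.2 (σ a)
      rw [← hσ]
      simpa using h1
  · push Not at h
    obtain ⟨i, hi⟩ := h
    rw [Finset.prod_eq_zero (Finset.mem_univ i) (if_neg hi), Finset.card_eq_zero,
      Finset.filter_eq_empty_iff]
    intro σ _ hσ
    refine hi (Fintype.card_congr (σ.subtypeEquiv fun a => ?_))
    rw [hσ]

end Fibers

/-! ### Wick's theorem in finitely many coordinates -/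

section Wick

/-- Grouping the factors by coordinate and using independence leaves one-dimensional moments. They
vanish unless `f` and `g` have equal fibre sizes `mᵢ`, and then the product of the `mᵢ!` is the
permutation count. -/
theorem integral_pi_complexGaussian {ι : Type*} [Fintype ι] [DecidableEq ι]
    (lam : ι → Set.Ioi (0 : ℝ)) {k : ℕ} (f g : Fin k → ι) :
    ∫ y : ι → ℂ, (∏ l, y (g l)) * ∏ l, starRingEnd ℂ (y (f l))
        ∂(Measure.pi fun i => complexGaussian (lam i)) =
      ((Finset.univ.filter fun σ : Equiv.Perm (Fin k) => ∀ l, f (σ l) = g l).card : ℂ) *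
        ∏ l, (((lam (f l) : ℝ)⁻¹ : ℝ) : ℂ) := by
  have hprob : ∀ i, IsProbabilityMeasure (complexGaussian (lam i)) :=
    fun i => isProbabilityMeasure_complexGaussian (lam i).2
  have hfib : ∀ (h : Fin k → ι) (w : ι → ℂ),
      ∏ l, w (h l) = ∏ i, w i ^ Fintype.card {l // h l = i} := by
    intro h w
    rw [← Finset.prod_fiberwise' Finset.univ h w]
    refine Finset.prod_congr rfl fun i _ => ?_
    rw [Finset.prod_const, Fintype.card_subtype]
  have e : ∀ y : ι → ℂ, (∏ l, y (g l)) * ∏ l, starRingEnd ℂ (y (f l)) =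
      ∏ i, (y i ^ Fintype.card {l // g l = i} *
        (starRingEnd ℂ (y i)) ^ Fintype.card {l // f l = i}) := by
    intro y
    rw [hfib g y, hfib f fun i => starRingEnd ℂ (y i), Finset.prod_mul_distrib]
  simp only [e]
  rw [integral_fintype_prod_eq_prod (𝕜 := ℂ) (fun i (z : ℂ) =>
    z ^ Fintype.card {l // g l = i} * (starRingEnd ℂ z) ^ Fintype.card {l // f l = i})]
  rw [card_perm_comp_eq, hfib f fun i => (((lam i : ℝ)⁻¹ : ℝ) : ℂ), Nat.cast_prod,
    ← Finset.prod_mul_distrib]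
  refine Finset.prod_congr rfl fun i _ => ?_
  rw [integral_pow_mul_conj_pow (lam i).2]
  split_ifs <;> simp

end Wick

/-! ### Orthonormal bases and coordinates of the Sobolev scale -/

section SobolevBasis

variable {ι : Type v} {lam : ι → Set.Ioi (0 : ℝ)} {s : ℝ}

/-- The orthonormal basis of `𝓗ˢ` whose elements have the coordinates `lamⱼ ^ (-s/2) δⱼ`. -/
def sobolevBasis (lam : ι → Set.Ioi (0 : ℝ)) (s : ℝ) : HilbertBasis ι ℂ (Sobolev lam s) :=
  HilbertBasis.ofRepr { toLinearEquiv := toL2 lam s, norm_map' := fun _ => rfl }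

theorem inner_sobolevBasis (j : ι) (u : Sobolev lam s) :
    ⟪sobolevBasis lam s j, u⟫_ℂ = (((lam j : ℝ) ^ (s / 2) : ℝ) : ℂ) * coord u j := by
  rw [← HilbertBasis.repr_apply_apply]
  rfl

theorem rpow_mul_rpow_neg (j : ι) (r : ℝ) :
    (((lam j : ℝ) ^ r : ℝ) : ℂ) * (((lam j : ℝ) ^ (-r) : ℝ) : ℂ) = 1 := by
  have h0 : 0 < (lam j : ℝ) := (lam j).2
  rw [← Complex.ofReal_mul, ← Real.rpow_add h0, add_neg_cancel, Real.rpow_zero, Complex.ofReal_one]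

theorem coord_eq_inner (j : ι) (u : Sobolev lam s) :
    coord u j = (((lam j : ℝ) ^ (-(s / 2)) : ℝ) : ℂ) * ⟪sobolevBasis lam s j, u⟫_ℂ := by
  rw [inner_sobolevBasis]
  linear_combination -(coord u j) * rpow_mul_rpow_neg (lam := lam) j (s / 2)

theorem continuous_coord : Continuous (coord : Sobolev lam s → ι → ℂ) := by
  refine continuous_pi fun j => ?_
  simp only [coord_eq_inner]
  fun_prop

variable [Countable ι]

theorem separableSpace_sobolev (lam : ι → Set.Ioi (0 : ℝ)) (s : ℝ) :
    TopologicalSpace.SeparableSpace (Sobolev lam s) := by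
  rw [← TopologicalSpace.isSeparable_univ_iff]
  have h := ((Set.countable_range (sobolevBasis lam s)).isSeparable.span (R := ℂ)).closure
  rwa [((Submodule.dense_iff_topologicalClosure_eq_top).mpr
    (sobolevBasis lam s).dense_span).closure_eq] at h

theorem secondCountableTopology_sobolev (lam : ι → Set.Ioi (0 : ℝ)) (s : ℝ) :
    SecondCountableTopology (Sobolev lam s) :=
  have := separableSpace_sobolev lam s
  UniformSpace.secondCountable_of_separable _

/-- Lusin–Souslin: a continuous injection of a Polish space is a measurable embedding. This makes
the `comap` in `gaussianMeasure` the genuine trace of the product measure. -/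
theorem measurableEmbedding_coord :
    MeasurableEmbedding (coord : Sobolev lam s → ι → ℂ) := by
  have := secondCountableTopology_sobolev lam s
  exact continuous_coord.measurableEmbedding coord_injective

end SobolevBasis

/-! ### The Gaussian measure: concentration, moments, Wick's theorem -/

section GaussianMeasure

variable {ι : Type v} {lam : ι → Set.Ioi (0 : ℝ)} {p : ℝ}

/-- The square of the norm of `𝓗^{1-p}`, as a function on `ι → ℂ`. -/
def weightedSq (lam : ι → Set.Ioi (0 : ℝ)) (p : ℝ) (α : ι → ℂ) : ℝ≥0∞ :=
  ∑' j, ENNReal.ofReal ((lam j : ℝ) ^ (1 - p)) * ENNReal.ofReal (‖α j‖ ^ 2)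

theorem weightedSq_coord (u : Sobolev lam (1 - p)) :
    weightedSq lam p (coord u) = ‖u‖ₑ ^ 2 := by
  have hw : ∀ j, 0 ≤ (lam j : ℝ) ^ (1 - p) := fun j => Real.rpow_nonneg (le_of_lt (lam j).2) _
  have h : ENNReal.ofReal (‖u‖ ^ 2) = weightedSq lam p (coord u) := by
    rw [norm_sq_eq, ENNReal.ofReal_tsum_of_nonneg
      (fun j => mul_nonneg (hw j) (by positivity)) (summable_coord u)]
    exact tsum_congr fun j => ENNReal.ofReal_mul (hw j)
  rw [← h, ENNReal.ofReal_pow (norm_nonneg u), ofReal_norm]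

theorem mem_range_coord {α : ι → ℂ} (h : weightedSq lam p α < ∞) :
    α ∈ Set.range (coord : Sobolev lam (1 - p) → ι → ℂ) := by
  have hw : ∀ j, 0 ≤ (lam j : ℝ) ^ (1 - p) := fun j => Real.rpow_nonneg (le_of_lt (lam j).2) _
  refine ⟨⟨α, ?_⟩, rfl⟩
  refine (ENNReal.summable_toReal h.ne).congr fun j => ?_
  rw [← ENNReal.ofReal_mul (hw j), ENNReal.toReal_ofReal (mul_nonneg (hw j) (by positivity))]

/-- The product of the Gaussian measures on `ι → ℂ`. -/
def gaussianProduct (lam : ι → Set.Ioi (0 : ℝ)) : Measure (ι → ℂ) :=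
  Measure.infinitePi fun i => complexGaussian (lam i)

instance isProbabilityMeasure_complexGaussian_coe (lam : ι → Set.Ioi (0 : ℝ)) (i : ι) :
    IsProbabilityMeasure (complexGaussian (lam i)) :=
  isProbabilityMeasure_complexGaussian (lam i).2

instance isProbabilityMeasure_gaussianProduct (lam : ι → Set.Ioi (0 : ℝ)) :
    IsProbabilityMeasure (gaussianProduct lam) := by
  unfold gaussianProduct; infer_instance

/-- With `X j = λⱼ^{1-p} |αⱼ|²` one has `E (X j)^k = k! λⱼ^{-pk}`. Expand the power over
multi-indices and bound each mixed moment by Hölder; the resulting sum factorises. -/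
theorem lintegral_weightedSq_pow_le [Countable ι] (lam : ι → Set.Ioi (0 : ℝ)) (p : ℝ) (k : ℕ)
    (hk : 1 ≤ k) : ∫⁻ α, weightedSq lam p α ^ k ∂(gaussianProduct lam) ≤
      (k ! : ℝ≥0∞) * (∑' j, ENNReal.ofReal ((lam j : ℝ) ^ (-p))) ^ k := by
  have hk0 : (k : ℝ) ≠ 0 := by positivity
  set X : ι → (ι → ℂ) → ℝ≥0∞ := fun j α =>
    ENNReal.ofReal ((lam j : ℝ) ^ (1 - p)) * ENNReal.ofReal (‖α j‖ ^ 2) with hX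
  have hXm : ∀ j, Measurable (X j) := fun j => by fun_prop
  have hmom : ∀ j, ∫⁻ α, X j α ^ k ∂(gaussianProduct lam) =
      (k ! : ℝ≥0∞) * ENNReal.ofReal ((lam j : ℝ) ^ (-p)) ^ k := by
    intro j
    have h0 : 0 < (lam j : ℝ) := (lam j).2
    simp only [hX, mul_pow]
    rw [lintegral_const_mul _ (by fun_prop)]
    have h1 : ∫⁻ α, ENNReal.ofReal (‖α j‖ ^ 2) ^ k ∂(gaussianProduct lam) =
        ∫⁻ z, ENNReal.ofReal (‖z‖ ^ 2) ^ k ∂(complexGaussian (lam j)) :=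
      (measurePreserving_eval_infinitePi (fun i => complexGaussian (lam i)) j).lintegral_comp
        (f := fun z : ℂ => ENNReal.ofReal (‖z‖ ^ 2) ^ k) (by fun_prop)
    rw [h1, lintegral_norm_pow_complexGaussian h0, ENNReal.ofReal_mul (by positivity),
      ENNReal.ofReal_natCast, ENNReal.ofReal_pow (by positivity), mul_left_comm, ← mul_pow,
      ← ENNReal.ofReal_mul (by positivity)]
    congr 4
    rw [← Real.rpow_neg_one, ← Real.rpow_add h0]
    congr 1
    ring
  have hexp : ∀ α, weightedSq lam p α ^ k = ∑' f : Fin k → ι, ∏ l, X (f l) α := fun α =>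
    (tsum_prod_eq_pow (fun j => X j α) k).symm
  simp only [hexp]
  rw [lintegral_tsum fun f =>
    (Finset.measurable_fun_prod _ fun l _ => hXm (f l)).aemeasurable, ← tsum_prod_eq_pow,
    ← ENNReal.tsum_mul_left]
  refine ENNReal.tsum_le_tsum fun f => ?_
  -- Hölder with `k` equal exponents `1/k`, applied to the functions `X (f l) ^ k`.
  have hH := ENNReal.lintegral_prod_norm_pow_le (μ := gaussianProduct lam)
    (Finset.univ : Finset (Fin k)) (f := fun l α => X (f l) α ^ k)
    (fun l _ => ((hXm (f l)).pow_const k).aemeasurable) (p := fun _ => (k : ℝ)⁻¹)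
    (by simp [hk0]) (fun _ _ => by positivity)
  have hr : ∀ x : ℝ≥0∞, (x ^ k) ^ (k : ℝ)⁻¹ = x := fun x => ENNReal.pow_rpow_inv_natCast
    (by omega) x
  simp only [hr, hmom] at hH
  refine hH.trans_eq ?_
  simp only [ENNReal.mul_rpow_of_nonneg _ _ (by positivity : (0 : ℝ) ≤ (k : ℝ)⁻¹), hr,
    Finset.prod_mul_distrib, Finset.prod_const, Finset.card_univ, Fintype.card_fin]
  rw [ENNReal.rpow_inv_natCast_pow (by omega)]

variable [Countable ι]

theorem measurable_weightedSq (lam : ι → Set.Ioi (0 : ℝ)) (p : ℝ) :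
    Measurable (weightedSq lam p) :=
  Measurable.tsum fun j => by fun_prop

/-- The weighted square norm has mean at most `∑ λⱼ^{-p} < ∞`, so almost every sequence lies in
`𝓗^{1-p}` and restriction to that space loses no mass. -/
theorem map_coord_gaussianMeasure (h : ∑' j, ENNReal.ofReal ((lam j : ℝ) ^ (-p)) < ∞) :
    (gaussianMeasure lam p).map coord = gaussianProduct lam := by
  rw [gaussianMeasure, measurableEmbedding_coord.map_comap]
  refine Measure.restrict_eq_self_of_ae_mem ?_
  have h1 : ∫⁻ α, weightedSq lam p α ∂(gaussianProduct lam) < ∞ := by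
    have := lintegral_weightedSq_pow_le lam p 1 le_rfl
    simp only [pow_one, Nat.factorial_one, Nat.cast_one, one_mul] at this
    exact this.trans_lt h
  filter_upwards [ae_lt_top (measurable_weightedSq lam p) h1.ne] with α hα
  exact mem_range_coord hα

theorem isProbabilityMeasure_gaussianMeasure
    (h : ∑' j, ENNReal.ofReal ((lam j : ℝ) ^ (-p)) < ∞) :
    IsProbabilityMeasure (gaussianMeasure lam p) := by
  refine ⟨?_⟩
  have h1 := congrArg (fun μ => μ Set.univ) (map_coord_gaussianMeasure h)
  simpa [Measure.map_apply measurableEmbedding_coord.measurable MeasurableSet.univ] using h1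

theorem map_restrict_gaussianMeasure
    (h : ∑' j, ENNReal.ofReal ((lam j : ℝ) ^ (-p)) < ∞) (s : Finset ι) :
    (gaussianMeasure lam p).map (fun (u : Sobolev lam (1 - p)) (i : s) => coord u i) =
      Measure.pi fun i : s => complexGaussian (lam i) := by
  rw [← Measure.infinitePi_map_restrict (fun i => complexGaussian (lam i))]
  change _ = (gaussianProduct lam).map s.restrict
  rw [← map_coord_gaussianMeasure h, Measure.map_map (Finset.measurable_restrict s)
    measurableEmbedding_coord.measurable]
  rfl

theorem lintegral_enorm_pow_lt_top (h : ∑' j, ENNReal.ofReal ((lam j : ℝ) ^ (-p)) < ∞) {k : ℕ}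
    (hk : 1 ≤ k) : ∫⁻ u, (‖u‖ₑ ^ 2) ^ k ∂(gaussianMeasure lam p) < ∞ := by
  simp only [← weightedSq_coord]
  rw [← lintegral_map ((measurable_weightedSq lam p).pow_const k)
    measurableEmbedding_coord.measurable, map_coord_gaussianMeasure h]
  refine (lintegral_weightedSq_pow_le lam p k hk).trans_lt ?_
  exact ENNReal.mul_lt_top (ENNReal.natCast_lt_top _) (ENNReal.pow_lt_top h)

/-- Wick's theorem for `μ₀`. -/
theorem integral_prod_coord [DecidableEq ι] (h : ∑' j, ENNReal.ofReal ((lam j : ℝ) ^ (-p)) < ∞)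
    {k : ℕ} (f g : Fin k → ι) :
    ∫ u, (∏ l, coord u (g l)) * ∏ l, starRingEnd ℂ (coord u (f l)) ∂(gaussianMeasure lam p) =
      ((Finset.univ.filter fun σ : Equiv.Perm (Fin k) => ∀ l, f (σ l) = g l).card : ℂ) *
        ∏ l, (((lam (f l) : ℝ)⁻¹ : ℝ) : ℂ) := by
  -- Only the coordinates occurring in `f` or `g` matter, which reduces to a finite product.
  set s : Finset ι := Finset.univ.image f ∪ Finset.univ.image g
  have hf : ∀ l, f l ∈ s := fun l =>
    Finset.mem_union_left _ (Finset.mem_image_of_mem f (Finset.mem_univ l))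
  have hg : ∀ l, g l ∈ s := fun l =>
    Finset.mem_union_right _ (Finset.mem_image_of_mem g (Finset.mem_univ l))
  have h1 := integral_pi_complexGaussian (fun i : s => lam i) (fun l => ⟨f l, hf l⟩)
    fun l => (⟨g l, hg l⟩ : s)
  rw [← map_restrict_gaussianMeasure h s, integral_map] at h1
  · simpa only [Subtype.mk.injEq] using h1
  · exact ((Finset.measurable_restrict s).comp
      measurableEmbedding_coord.measurable).aemeasurable
  · exact Continuous.aestronglyMeasurable (by fun_prop)

end GaussianMeasure

/-! ### Construction of diagonal operators -/

section Diagonal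

variable {E : Type u} [NormedAddCommGroup E] [InnerProductSpace ℂ E]
variable {F : Type v} [NormedAddCommGroup F] [InnerProductSpace ℂ F] {ι : Type*}

/-- A bounded family defines a bounded operator that is diagonal in a pair of orthonormal bases. -/
theorem exists_diagonal (b : HilbertBasis ι ℂ E) (b' : HilbertBasis ι ℂ F) {c : ι → ℂ} {C : ℝ}
    (hC : ∀ i, ‖c i‖ ≤ C) : ∃ T : E →L[ℂ] F, ∀ i, T (b i) = c i • b' i := by
  classical
  have hle : ∀ (x : E) i, ‖c i * b.repr x i‖ ≤ ‖((C : ℂ) • b.repr x) i‖ := by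
    intro x i
    rw [lp.coeFn_smul, Pi.smul_apply, norm_smul, norm_mul, Complex.norm_real]
    gcongr
    exact (hC i).trans (le_abs_self C)
  have hmem : ∀ x : E, Memℓp (fun i => c i * b.repr x i) 2 := by
    intro x
    have h := (lp.memℓp ((C : ℂ) • b.repr x)).summable (by norm_num)
    refine memℓp_gen (Summable.of_nonneg_of_le (fun i => by positivity) (fun i => ?_) h)
    exact Real.rpow_le_rpow (norm_nonneg _) (hle x i) (by norm_num)
  let D : E →ₗ[ℂ] lp (fun _ : ι => ℂ) 2 :=
    { toFun := fun x => ⟨fun i => c i * b.repr x i, hmem x⟩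
      map_add' := fun x y => by
        ext i
        change c i * b.repr (x + y) i = c i * b.repr x i + c i * b.repr y i
        simp [mul_add]
      map_smul' := fun a x => by
        ext i
        simp [mul_left_comm] }
  let D' : E →L[ℂ] lp (fun _ : ι => ℂ) 2 := D.mkContinuous |C| fun x => by
    have h := lp.norm_mono (p := 2) (by norm_num) (x := D x) (y := (C : ℂ) • b.repr x) (hle x)
    rwa [norm_smul, Complex.norm_real, LinearIsometryEquiv.norm_map] at h
  refine ⟨(b'.repr.symm : lp (fun _ : ι => ℂ) 2 →L[ℂ] F) ∘L D', fun i => ?_⟩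
  have h : D (b i) = c i • b'.repr (b' i) := by
    ext j
    change c j * b.repr (b i) j = c i * b'.repr (b' i) j
    rw [HilbertBasis.repr_self, HilbertBasis.repr_self]
    by_cases hij : j = i
    · rw [hij]
    · simp [hij]
  change b'.repr.symm (D (b i)) = _
  rw [h, map_smul, LinearIsometryEquiv.symm_apply_apply]

end Diagonal

/-! ### The vectors `x^{⊗k}` and rank-one operators -/

section SymPow

variable {E : Type u} [NormedAddCommGroup E] [InnerProductSpace ℂ E] {k : ℕ}

theorem inner_symPow (x y : E) : ⟪symPow k x, symPow k y⟫_ℂ = ⟪x, y⟫_ℂ ^ k := by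
  rw [← inner_symIncl, symIncl_symPow, symIncl_symPow, inner_tensor]
  simp

theorem norm_symPow (x : E) : ‖symPow k x‖ = ‖x‖ ^ k := by
  change ‖tensor fun _ : Fin k => x‖ = _
  rw [norm_tensor]
  simp

/-- Expanding the square expresses `‖y^{⊗k} - x^{⊗k}‖` through norms and `⟪y, x⟫ ^ k`, which are
continuous in `y`. -/
theorem continuous_symPow (k : ℕ) : Continuous (symPow k : E → SymPower E k) := by
  refine continuous_iff_continuousAt.mpr fun x => ?_
  rw [ContinuousAt, tendsto_iff_norm_sub_tendsto_zero]
  have h : ∀ y, ‖symPow k y - symPow k x‖ =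
      √((‖y‖ ^ k) ^ 2 - 2 * RCLike.re (⟪y, x⟫_ℂ ^ k) + (‖x‖ ^ k) ^ 2) := by
    intro y
    rw [← norm_symPow (k := k) y, ← norm_symPow (k := k) x, ← inner_symPow, ← norm_sub_sq, Real.sqrt_sq (norm_nonneg _)]
  have hc : Continuous fun y : E =>
      √((‖y‖ ^ k) ^ 2 - 2 * RCLike.re (⟪y, x⟫_ℂ ^ k) + (‖x‖ ^ k) ^ 2) := by fun_prop
  have h0 := hc.tendsto x
  rw [← h x, sub_self, norm_zero] at h0
  exact h0.congr fun y => (h y).symm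

theorem inner_symPow_symTensor (x : E) (y : Fin k → E) :
    ⟪symPow k x, symTensor y⟫_ℂ = ((√(k ! : ℝ) : ℝ) : ℂ) * ∏ l, ⟪x, y l⟫_ℂ := by
  rw [← inner_conj_symm, inner_symTensor, symIncl_symPow, inner_tensor]
  simp only [map_mul, map_prod, Complex.conj_ofReal, inner_conj_symm]

end SymPow

theorem continuous_rankOne {E : Type u} [NormedAddCommGroup E] [InnerProductSpace ℂ E]
    {F : Type v} [NormedAddCommGroup F] [InnerProductSpace ℂ F] :
    Continuous fun q : E × F => InnerProductSpace.rankOne ℂ q.1 q.2 := by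
  have h2 : Continuous fun q : E × F => innerSL ℂ q.2 :=
    (innerSL ℂ (E := F)).continuous.comp continuous_snd
  have h3 : Continuous fun q : E × F => ContinuousLinearMap.toSpanSingleton ℂ q.1 :=
    (ContinuousLinearMap.toSpanSingletonCLE (𝕜 := ℂ) (E := E)).continuous.comp continuous_fst
  simp only [InnerProductSpace.rankOne_def']
  exact h3.clm_comp h2

/-! ### The density matrix and its matrix elements -/

section Density

variable {ι : Type v} {lam : ι → Set.Ioi (0 : ℝ)} {p : ℝ} {k : ℕ}

theorem inner_sobolevBasis_rieszRep (j : ι) (u : Sobolev lam (1 - p)) :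
    ⟪sobolevBasis lam (p - 1) j, rieszRep lam p u⟫_ℂ = ⟪sobolevBasis lam (1 - p) j, u⟫_ℂ := by
  rw [inner_sobolevBasis, inner_sobolevBasis]
  change _ * ((((lam j : ℝ) ^ (1 - p) : ℝ) : ℂ) * coord u j) = _
  rw [← mul_assoc, ← Complex.ofReal_mul, ← Real.rpow_add (lam j).2]
  congr 4
  ring

/-- The duality map matches the normalised bases of `𝓗^{1-p}` and `𝓗^{p-1}`, since `(p-1)/2 + (1-p)
= (1-p)/2`; it is therefore isometric and continuous. -/
theorem rieszRep_eq (u : Sobolev lam (1 - p)) : rieszRep lam p u =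
    (sobolevBasis lam (p - 1)).repr.symm ((sobolevBasis lam (1 - p)).repr u) := by
  rw [LinearIsometryEquiv.eq_symm_apply]
  ext j
  rw [HilbertBasis.repr_apply_apply, HilbertBasis.repr_apply_apply, inner_sobolevBasis_rieszRep]

theorem continuous_rieszRep : Continuous (rieszRep lam p) := by
  rw [funext rieszRep_eq]
  fun_prop

theorem norm_rieszRep (u : Sobolev lam (1 - p)) : ‖rieszRep lam p u‖ = ‖u‖ := by
  rw [rieszRep_eq, LinearIsometryEquiv.norm_map, LinearIsometryEquiv.norm_map]

theorem continuous_ketBra (lam : ι → Set.Ioi (0 : ℝ)) (p : ℝ) (k : ℕ) :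
    Continuous (ketBra lam p k) := by
  have h1 : Continuous fun u : Sobolev lam (1 - p) => symPow k u := continuous_symPow k
  have h2 : Continuous fun u : Sobolev lam (1 - p) => symPow k (rieszRep lam p u) :=
    (continuous_symPow k).comp continuous_rieszRep
  have h3 := h1.prodMk h2
  have h4 := continuous_rankOne (E := SymPower (Sobolev lam (1 - p)) k)
    (F := SymPower (Sobolev lam (p - 1)) k)
  have h5 := h4.comp h3
  exact h5

theorem integrable_ketBra [Countable ι] (h : ∑' j, ENNReal.ofReal ((lam j : ℝ) ^ (-p)) < ∞)
    (hk : 1 ≤ k) : Integrable (ketBra lam p k) (gaussianMeasure lam p) := by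
  have := secondCountableTopology_sobolev lam (1 - p)
  refine ⟨(continuous_ketBra lam p k).aestronglyMeasurable, ?_⟩
  rw [hasFiniteIntegral_iff_enorm]
  refine (lintegral_congr fun u => ?_).trans_lt (lintegral_enorm_pow_lt_top h hk)
  have hn : ‖ketBra lam p k u‖ = (‖u‖ ^ 2) ^ k := by
    rw [ketBra, InnerProductSpace.norm_rankOne, norm_symPow, norm_symPow, norm_rieszRep]
    ring
  rw [← ofReal_norm, hn, ENNReal.ofReal_pow (by positivity), ENNReal.ofReal_pow (by positivity),
    ofReal_norm]

/-- The matrix element is, up to constants, the monomial of Wick's theorem. The powers of `lam` come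
from normalising the bases, and `√k!` from pairing with a symmetrised product. -/
theorem inner_tensor_ketBra (f g : Fin k → ι) (u : Sobolev lam (1 - p)) :
    ⟪tensor fun l => sobolevBasis lam (1 - p) (g l),
      symIncl _ k (ketBra lam p k u (symTensor fun l => sobolevBasis lam (p - 1) (f l)))⟫_ℂ =
    ((√(k ! : ℝ) : ℝ) : ℂ) * (∏ l, (((lam (f l) : ℝ) ^ ((1 - p) / 2) : ℝ) : ℂ)) *
      (∏ l, (((lam (g l) : ℝ) ^ ((1 - p) / 2) : ℝ) : ℂ)) *
      ((∏ l, coord u (g l)) * ∏ l, starRingEnd ℂ (coord u (f l))) := by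
  rw [ketBra, InnerProductSpace.rankOne_apply, map_smul, inner_smul_right, symIncl_symPow,
    inner_tensor, inner_symPow_symTensor]
  have h1 : ∀ j, ⟪rieszRep lam p u, sobolevBasis lam (p - 1) j⟫_ℂ =
      (((lam j : ℝ) ^ ((1 - p) / 2) : ℝ) : ℂ) * starRingEnd ℂ (coord u j) := by
    intro j
    rw [← inner_conj_symm, inner_sobolevBasis_rieszRep, inner_sobolevBasis, map_mul,
      Complex.conj_ofReal]
  simp only [h1, inner_sobolevBasis, Finset.prod_mul_distrib]
  ring

theorem sum_prod_inner_basis {E : Type u} [NormedAddCommGroup E] [InnerProductSpace ℂ E]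
    [DecidableEq ι] (b : HilbertBasis ι ℂ E) (f g : Fin k → ι) :
    ∑ σ : Equiv.Perm (Fin k), ∏ l, ⟪b (g l), b (f (σ l))⟫_ℂ =
      ((Finset.univ.filter fun σ : Equiv.Perm (Fin k) => ∀ l, f (σ l) = g l).card : ℂ) := by
  simp only [orthonormal_iff_ite.mp b.orthonormal, Finset.prod_ite_zero, Finset.prod_const_one,
    Finset.mem_univ, forall_const, Finset.sum_boole, eq_comm]

/-- If the count is nonzero, `g` is a rearrangement of `f` and the products agree. -/
theorem card_perm_mul_prod_eq [DecidableEq ι] (f g : Fin k → ι) (w : ι → ℂ) :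
    ((Finset.univ.filter fun σ : Equiv.Perm (Fin k) => ∀ l, f (σ l) = g l).card : ℂ) *
        ∏ l, w (g l) =
      ((Finset.univ.filter fun σ : Equiv.Perm (Fin k) => ∀ l, f (σ l) = g l).card : ℂ) *
        ∏ l, w (f l) := by
  rcases Finset.eq_empty_or_nonempty
    (Finset.univ.filter fun σ : Equiv.Perm (Fin k) => ∀ l, f (σ l) = g l) with h | ⟨σ, hσ⟩
  · rw [h]; simp
  · rw [Finset.mem_filter] at hσ
    simp only [← hσ.2]
    rw [Equiv.prod_comp σ fun l => w (f l)]

variable {H : Type u} [NormedAddCommGroup H] [InnerProductSpace ℂ H]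

/-- Both sides are tested on symmetrised basis products against the product basis. Wick's theorem on
the left and symmetrisation on the right produce the same permutation count. -/
theorem densityMatrix_eq [Countable ι] (h : ∑' j, ENNReal.ofReal ((lam j : ℝ) ^ (-p)) < ∞)
    (hk : 1 ≤ k) {b : HilbertBasis ι ℂ H} {T : H →L[ℂ] H} {J : Sobolev lam (p - 1) →L[ℂ] H}
    {J' : H →L[ℂ] Sobolev lam (1 - p)}
    (hT : ∀ i, T (b i) = (((lam i : ℝ)⁻¹ : ℝ) : ℂ) • b i)
    (hJ : ∀ i, J (sobolevBasis lam (p - 1) i) =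
      (((lam i : ℝ) ^ ((1 - p) / 2) : ℝ) : ℂ) • b i)
    (hJ' : ∀ i, J' (b i) =
      (((lam i : ℝ) ^ ((1 - p) / 2) : ℝ) : ℂ) • sobolevBasis lam (1 - p) i) :
    densityMatrix lam p k = symMap k J' ∘L ((k ! : ℂ) • symMap k T) ∘L symMap k J := by
  classical
  refine ContinuousLinearMap.ext_on (dense_span_symTensor (sobolevBasis lam (p - 1)) k) ?_
  rintro _ ⟨f, rfl⟩
  refine symPower_ext (sobolevBasis lam (1 - p)) fun g => ?_
  set t := symTensor (k := k) fun l => sobolevBasis lam (p - 1) (f l)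
  set N : ℂ :=
    ((Finset.univ.filter fun σ : Equiv.Perm (Fin k) => ∀ l, f (σ l) = g l).card : ℂ) with hN
  -- A matrix element is a bounded linear functional of the operator, so it passes under the Bochner
  -- integral.
  have hL := ((innerSL ℂ (tensor fun l => sobolevBasis lam (1 - p) (g l))) ∘L
    (symIncl (Sobolev lam (1 - p)) k ∘L
      ContinuousLinearMap.apply ℂ (SymPower (Sobolev lam (1 - p)) k) t)).integral_comp_comm
    (integrable_ketBra h hk)
  change ∫ u, ⟪tensor fun l => sobolevBasis lam (1 - p) (g l),
    symIncl _ k (ketBra lam p k u t)⟫_ℂ ∂(gaussianMeasure lam p) =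
    ⟪tensor fun l => sobolevBasis lam (1 - p) (g l), symIncl _ k (densityMatrix lam p k t)⟫_ℂ at hL
  simp only [t, inner_tensor_ketBra] at hL
  rw [integral_const_mul, integral_prod_coord h, ← hN] at hL
  rw [← hL]
  simp only [ContinuousLinearMap.comp_apply, smul_apply, symMap_symTensor_basis hJ, map_smul,
    symMap_symTensor_basis hT, symMap_symTensor_basis hJ', inner_smul_right, symIncl_symTensor,
    inner_tensor_symProd, sum_prod_inner_basis]
  rw [← hN]
  -- The weights of the target basis carry the index `g` on the left and `f` on the right; the count
  -- `N` makes them interchangeable.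
  have hw := card_perm_mul_prod_eq f g fun j => (((lam j : ℝ) ^ ((1 - p) / 2) : ℝ) : ℂ)
  rw [← hN] at hw
  have hs : ((√(k ! : ℝ) : ℝ) : ℂ) = (k ! : ℂ) * (((√(k ! : ℝ))⁻¹ : ℝ) : ℂ) := by
    have hk : (0 : ℝ) < k ! := by positivity
    have : √(k ! : ℝ) = (k ! : ℝ) * (√(k ! : ℝ))⁻¹ := by
      rw [eq_mul_inv_iff_mul_eq₀ (by positivity), Real.mul_self_sqrt hk.le]
    exact_mod_cast congrArg (fun r : ℝ => (r : ℂ)) this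
  rw [hs]
  set A := ∏ l, (((lam (f l) : ℝ) ^ ((1 - p) / 2) : ℝ) : ℂ)
  set I := ∏ l, (((lam (f l) : ℝ)⁻¹ : ℝ) : ℂ)
  linear_combination (k ! : ℂ) * (((√(k ! : ℝ))⁻¹ : ℝ) : ℂ) * A * I * hw

end Density

end FreeGibbs

end

/-! ### Assembly of the theorem -/

theorem lemma3p3 {H : Type u} [NormedAddCommGroup H] [InnerProductSpace ℂ H]
    [CompleteSpace H] [TopologicalSpace.SeparableSpace H]
    (h : H →ₗ.[ℂ] H) (hsa : IsSelfAdjoint h)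
    (hpos : ∀ x : h.domain, 0 ≤ RCLike.re ⟪(x : H), h x⟫_ℂ)
    (hinv : H →L[ℂ] H) (hinv_spec : FreeGibbs.IsBoundedInverse h hinv)
    (p : ℝ) (hp : 1 ≤ p)
    (htr : FreeGibbs.posTrace (FreeGibbs.opPow hinv p) < ∞) :
    -- `h` has an orthonormal basis of eigenvectors, with positive eigenvalues
    (∃ (ι : Type u) (b : HilbertBasis ι ℂ H) (lam : ι → Set.Ioi (0 : ℝ)),
      FreeGibbs.IsEigenbasis h b lam) ∧
    ∀ (ι : Type v) (b : HilbertBasis ι ℂ H) (lam : ι → Set.Ioi (0 : ℝ)),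
      FreeGibbs.IsEigenbasis h b lam →
      -- the Gaussian measure is a probability measure on `𝓗^{1-p}`, with the right
      -- finite-dimensional projections
      IsProbabilityMeasure (FreeGibbs.gaussianMeasure lam p) ∧
      (∀ s : Finset ι,
        (FreeGibbs.gaussianMeasure lam p).map
            (fun (u : FreeGibbs.Sobolev lam (1 - p)) (i : s) => FreeGibbs.coord u i) =
          Measure.pi fun i : s => FreeGibbs.complexGaussian (lam i)) ∧
      -- the embeddings `𝓗^{p-1} ⊂ 𝓗 ⊂ 𝓗^{1-p}`
      ∃ (J : FreeGibbs.Sobolev lam (p - 1) →L[ℂ] H) (J' : H →L[ℂ] FreeGibbs.Sobolev lam (1 - p)),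
        (∀ α j, ⟪b j, J α⟫_ℂ = FreeGibbs.coord α j) ∧
        (∀ x j, FreeGibbs.coord (J' x) j = ⟪b j, x⟫_ℂ) ∧
        ∀ k : ℕ, 1 ≤ k →
          -- the integral that defines the density matrix converges
          Integrable (FreeGibbs.ketBra lam p k) (FreeGibbs.gaussianMeasure lam p) ∧
          ∃ G : FreeGibbs.SymPower H k →L[ℂ] FreeGibbs.SymPower H k,
            G = (k ! : ℂ) • FreeGibbs.symMap k hinv ∧
            -- `G` extends the density matrix to `⨂ₛᵏ 𝓗`
            FreeGibbs.densityMatrix lam p k =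
              FreeGibbs.symMap k J' ∘L G ∘L FreeGibbs.symMap k J ∧
            -- and is the only bounded operator that does
            (∀ G' : FreeGibbs.SymPower H k →L[ℂ] FreeGibbs.SymPower H k,
              FreeGibbs.densityMatrix lam p k =
                FreeGibbs.symMap k J' ∘L G' ∘L FreeGibbs.symMap k J → G' = G) ∧
            IsCompactOperator G ∧
            G.IsPositive ∧
            FreeGibbs.posTrace (FreeGibbs.opPow G p) ≤
              ENNReal.ofReal ((k ! : ℝ) ^ p) *
                FreeGibbs.posTrace (FreeGibbs.opPow hinv p) ^ k ∧
            ENNReal.ofReal ((k ! : ℝ) ^ p) *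
                FreeGibbs.posTrace (FreeGibbs.opPow hinv p) ^ k < ∞ := by
  have hp0 : 0 < p := by linarith
  have hTp := hinv_spec.isPositive hsa hpos
  refine ⟨hinv_spec.exists_isEigenbasis hTp
    (FreeGibbs.isCompactOperator_of_posTrace_opPow_lt_top hTp hp0 htr), fun ι b lam hb => ?_⟩
  have hT := hinv_spec.apply_eigenbasis hb
  have hlam : ∀ i, 0 < (lam i : ℝ) := fun i => (lam i).2
  have hinv0 : ∀ i, 0 ≤ (lam i : ℝ)⁻¹ := fun i => (inv_pos.mpr (hlam i)).le
  have hsum := FreeGibbs.posTrace_opPow_eq b hTp hT hp0.le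
  have hS : ∑' i, ENNReal.ofReal ((lam i : ℝ) ^ (-p)) < ∞ := by
    rw [hsum] at htr
    simpa only [Real.rpow_neg (hlam _).le, Real.inv_rpow (hlam _).le] using htr
  -- A convergent sum of strictly positive terms has a countable index set.
  have hcount : Countable ι := by
    rw [← Set.countable_univ_iff]
    refine (Summable.countable_support_ennreal hS.ne).mono fun i _ => ?_
    simpa using Real.rpow_pos_of_pos (hlam i) (-p)
  have hle : ∀ i, (lam i : ℝ)⁻¹ ≤ ‖hinv‖ := by
    intro i
    have h1 := hinv.le_opNorm (b i)
    rwa [hT, norm_smul, b.orthonormal.1 i, mul_one, mul_one, Complex.norm_real,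
      Real.norm_of_nonneg (hinv0 i)] at h1
  -- The vector `b i` is `lam i ^ ((1-p)/2)` times the normalised basis vector of `𝓗^{1-p}`, and
  -- that of `𝓗^{p-1}` embeds as the same multiple of `b i`. Since `p ≥ 1`, the bound `1 / lam i ≤
  -- ‖hinv‖` makes both embeddings bounded.
  have hbound : ∀ i, ‖(((lam i : ℝ) ^ ((1 - p) / 2) : ℝ) : ℂ)‖ ≤ ‖hinv‖ ^ ((p - 1) / 2) := by
    intro i
    rw [Complex.norm_real, Real.norm_of_nonneg (Real.rpow_nonneg (hlam i).le _)]
    have e : (1 - p) / 2 = -((p - 1) / 2) := by ring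
    rw [e, Real.rpow_neg (hlam i).le, ← Real.inv_rpow (hlam i).le]
    exact Real.rpow_le_rpow (hinv0 i) (hle i) (by linarith)
  have hne : ∀ i, (((lam i : ℝ) ^ ((1 - p) / 2) : ℝ) : ℂ) ≠ 0 := fun i =>
    Complex.ofReal_ne_zero.mpr (Real.rpow_pos_of_pos (hlam i) _).ne'
  obtain ⟨J, hJ⟩ := FreeGibbs.exists_diagonal (FreeGibbs.sobolevBasis lam (p - 1)) b hbound
  obtain ⟨J', hJ'⟩ := FreeGibbs.exists_diagonal b (FreeGibbs.sobolevBasis lam (1 - p)) hbound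
  refine ⟨FreeGibbs.isProbabilityMeasure_gaussianMeasure hS,
    FreeGibbs.map_restrict_gaussianMeasure hS, J, J', fun α j => ?_, fun x j => ?_,
    fun k hk => ⟨FreeGibbs.integrable_ketBra hS hk, _, rfl, ?_⟩⟩
  · rw [FreeGibbs.inner_apply_of_diagonal _ b hJ, FreeGibbs.inner_sobolevBasis, ← mul_assoc]
    have e : (1 - p) / 2 = -((p - 1) / 2) := by ring
    rw [e, mul_comm (Complex.ofReal _), FreeGibbs.rpow_mul_rpow_neg, one_mul]
  · rw [FreeGibbs.coord_eq_inner, FreeGibbs.inner_apply_of_diagonal b _ hJ', ← mul_assoc,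
      mul_comm (Complex.ofReal _), FreeGibbs.rpow_mul_rpow_neg, one_mul]
  have hD := FreeGibbs.densityMatrix_eq hS hk hT hJ hJ'
  have hk0 : (0 : ℝ) ≤ k ! := Nat.cast_nonneg _
  have hpos' := FreeGibbs.isPositive_smul_symMap hinv0 hT k hk0
  have htr' := FreeGibbs.posTrace_opPow_symMap_le hinv0 hT k hk0 hp0.le
  rw [← hsum, Complex.ofReal_natCast] at htr'
  rw [Complex.ofReal_natCast] at hpos'
  have hfin : ENNReal.ofReal ((k ! : ℝ) ^ p) *
      FreeGibbs.posTrace (FreeGibbs.opPow hinv p) ^ k < ∞ :=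
    ENNReal.mul_lt_top ENNReal.ofReal_lt_top (ENNReal.pow_lt_top htr)
  refine ⟨hD, fun G' hG' => ?_, FreeGibbs.isCompactOperator_of_posTrace_opPow_lt_top hpos' hp0
    (htr'.trans_lt hfin), hpos', htr', hfin⟩
  refine FreeGibbs.eq_of_comp_symMap_eq hJ hne (ContinuousLinearMap.ext fun t => ?_)
  exact FreeGibbs.symMap_injective_of_diagonal hJ' hne (DFunLike.congr_fun (hG'.symm.trans hD) t)
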